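/- Let $X$ be a finite poset with $d=|X|$ elements and let $G$ be a finite group acting on $X$ by poset automorphisms. Let $J(X)$ be the poset of lower order ideals of $X$ ordered by inclusion, and let $\Delta=\Delta(J(X))$ be its order complex, the simplicial complex of all chains of $J(X)$ (including the empty chain), with the induced $G$-action $J\mapsto gJ$ on vertices. Color each vertex $J$ of $\Delta$ by its rank $|J|\in\{0,\dots,d\}$; this coloring is $G$-invariant. For $S\subseteq\{0,\dots,d\}$ let $\Delta|_S$ be the subcomplex of those chains all of whose members have rank in $S$. A function $G\to\mathbb C$ is called effective if it is the character of a (possibly zero) finite-dimensional complex representation of $G$. Let $\mathfrak f_{i-1}$ be the character of the complex permutation representation of $G$ on the faces of $\Delta$ with $i$ elements, and $\mathfrak f_S$ the one on the faces of $\Delta$ whose set of ranks is exactly $S$. The equivariant $h$-vector and flag $h$-vector of $\Delta$ have the entries $$\mathfrak h_k=\sum_{i=0}^k(-1)^{k-i}\binom{d+1-i}{k-i}\mathfrak f_{i-1}\quad(0\le k\le d+1),\qquad \mathfrak h_S=\sum_{T\subseteq S}(-1)^{|S|-|T|}\mathfrak f_T\quad(S\subseteq\{0,\dots,d\}),$$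 and $\mathfrak h_k=0$ for $k>d+1$. The equivariant Hilbert series of the Stanley–Reisner ring $\mathbb C[\Delta]$ is $\operatorname{Hilb}_G(\mathbb C[\Delta],t)=\sum_{i\ge0}\chi_{\mathbb C[\Delta]_i}t^i$, where $\chi_{\mathbb C[\Delta]_i}$ is the character of $G$ on the homogeneous component of degree $i$. Let $G$ act on $\mathbb R^X$ by $gf=f\circ g^{-1}$, and let $$\mathscr O(X)=\{f\in\mathbb R^X\mid 0\le f(x)\le f(x')\le1\text{ for all }x\le x'\text{ in }X\}$$ be the order polytope of $X$. If $\mathscr O(X)$ is $G$-invariant, its equivariant Ehrhart series is $\operatorname{Ehr}_G(\mathscr O(X),t)=1+\sum_{m\ge1}\chi_mt^m$, where $\chi_m$ is the character of the complex permutation representation of $G$ on $m\mathscr O(X)\cap\mathbb Z^X$. **Theorem.** The order polytope $\mathscr O(X)$ is $G$-invariant, and the following hold. 1. $\operatorname{Ehr}_G(\mathscr O(X),t)=\operatorname{Hilb}_G(\mathbb C[\Delta],t)$. 2. $\displaystyle\operatorname{Ehr}_G(\mathscr O(X),t)=\frac1{(1-t)^{d+1}}\sum_{S\subseteq\{1,\dots,d-1\}}\mathfrak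 h_S\,t^{|S|}$. 3. For every $S\subseteq\{1,\dots,d-1\}$ the reduced homology $\widetilde H_i(\Delta|_S,\mathbb C)$ vanishes for all $i\ne|S|-1$, and $\mathfrak h_S$ is the character of the representation of $G$ on $\widetilde H_{|S|-1}(\Delta|_S,\mathbb C)$. 4. Every $\mathfrak h_k$ with $k\ge0$ and every $\mathfrak h_S$ with $S\subseteq\{0,\dots,d\}$ is effective. 5. For every $i\ge0$, $\displaystyle\mathfrak h_i=\sum_{S\subseteq\{0,\dots,d\},\,|S|=i}\mathfrak h_S=\sum_{S\subseteq\{1,\dots,d-1\},\,|S|=i}\mathfrak h_S$. -/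

import Mathlib

open scoped Pointwise

/-! ### Characters and permutation representations of a group -/

/-- A complex-valued function on `G` is *effective* if it is the character of a genuine
finite-dimensional complex representation of `G` (the zero representation is allowed). -/
def IsEffective {G : Type*} [Group G] (χ : G → ℂ) : Prop :=
  ∃ (n : ℕ) (τ : Representation ℂ G (Fin n → ℂ)), τ.character = χ

/-- The permutation representation over the field `𝕜` on the vector space with basis `Y`, for an action of `G` on `Y` given by a homomorphism to the symmetric group. -/
noncomputable def permRep (𝕜 : Type*) [Field 𝕜] {G Y : Type*} [Group G] (φ : G →* Equiv.Perm Y) :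
    Representation 𝕜 G (Y →₀ 𝕜) where
  toFun g := Finsupp.lmapDomain 𝕜 𝕜 (φ g)
  map_one' := by ext; simp
  map_mul' x y := by ext; simp

/-- The action of `G` on an invariant subset `A` of `Y`. -/
def restrictPerm {G Y : Type*} [Group G] (φ : G →* Equiv.Perm Y) (A : Set Y)
    (hA : ∀ g, ∀ y ∈ A, φ g y ∈ A) : G →* Equiv.Perm A where
  toFun g := (φ g).subtypePerm fun y =>
    ⟨fun h => by simpa using hA g⁻¹ _ h, hA g y⟩
  map_one' := by ext; simp
  map_mul' x y := by
    ext z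
    change φ (x * y) z = φ x (φ y z)
    rw [map_mul, Equiv.Perm.mul_apply]

/-- The character of the complex permutation representation of `G` on an invariant subset `A`
of `Y` (used for finite `A`). -/
noncomputable def permChar {G Y : Type*} [Group G] (φ : G →* Equiv.Perm Y) (A : Set Y)
    (hA : ∀ g, ∀ y ∈ A, φ g y ∈ A) : G → ℂ :=
  (permRep ℂ (restrictPerm φ A hA)).character

/-- The quotient `Z / (B ∩ Z)` for subspaces `B`, `Z` of a vector space `C`; this is `Z / B` when
`B` is contained in `Z`. -/
def SubQuotient {𝕜 C : Type*} [Field 𝕜] [AddCommGroup C] [Module 𝕜 C] (Z B : Submodule 𝕜 C) :=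
  Z ⧸ B.submoduleOf Z

instance {𝕜 C : Type*} [Field 𝕜] [AddCommGroup C] [Module 𝕜 C] (Z B : Submodule 𝕜 C) :
    AddCommGroup (SubQuotient Z B) :=
  inferInstanceAs (AddCommGroup (Z ⧸ B.submoduleOf Z))

instance {𝕜 C : Type*} [Field 𝕜] [AddCommGroup C] [Module 𝕜 C] (Z B : Submodule 𝕜 C) :
    Module 𝕜 (SubQuotient Z B) :=
  inferInstanceAs (Module 𝕜 (Z ⧸ B.submoduleOf Z))

/-- The representation induced on `Z / B` by a representation on `C` that leaves `Z` and `B`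
invariant. -/
def subQuotientRep {𝕜 C G : Type*} [Field 𝕜] [AddCommGroup C] [Module 𝕜 C] [Group G]
    (τ : Representation 𝕜 G C) (Z B : Submodule 𝕜 C) (hZ : ∀ g, Z ≤ Z.comap (τ g))
    (hB : ∀ g, B ≤ B.comap (τ g)) : Representation 𝕜 G (SubQuotient Z B) :=
  (τ.subrepresentation Z hZ).quotient (B.submoduleOf Z) fun g _ hx => hB g hx

/-! ### Simplicial complexes with a group action -/

/-- An abstract simplicial complex on `V`: a family of finite subsets of `V` closed under
taking subsets (the empty set is allowed as a face). -/
abbrev FaceComplex (V : Type*) := LowerSet (Finset V)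

/-- The action on finite subsets of `V` induced by an action on `V`. -/
def finsetPerm {G V : Type*} [Group G] (φ : G →* Equiv.Perm V) :
    G →* Equiv.Perm (Finset V) where
  toFun g := (φ g).finsetCongr
  map_one' := by
    ext σ : 1
    rw [map_one]
    exact Finset.map_refl
  map_mul' x y := by
    ext σ : 1
    rw [map_mul]
    exact (Finset.map_map (φ y).toEmbedding (φ x).toEmbedding σ).symm

/-- An action of `G` on a simplicial complex: an action on `V` that maps faces to faces. -/
structure ComplexAction (G : Type*) [Group G] {V : Type*} (K : FaceComplex V) where
  toPerm : G →* Equiv.Perm V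
  map_mem : ∀ g, ∀ σ ∈ K, finsetPerm toPerm g σ ∈ K

/-- A proper coloring: distinct vertices of a face have distinct colors. -/
structure ProperColoring {V : Type*} (K : FaceComplex V) (Γ : Type*) where
  color : V → Γ
  injOn : ∀ σ ∈ K, Set.InjOn color (σ : Set V)

/-- The action `A` preserves the coloring `γ`. -/
def ComplexAction.Preserves {G V Γ : Type*} [Group G] {K : FaceComplex V}
    (A : ComplexAction G K) (γ : ProperColoring K Γ) : Prop :=
  ∀ g v, γ.color (A.toPerm g v) = γ.color v

/-! ### The Stanley--Reisner ring and its equivariant Hilbert series -/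

section StanleyReisner

variable (𝕜 : Type*) [Field 𝕜] {V : Type*} (K : FaceComplex V)

/-- The Stanley--Reisner ideal, generated by the squarefree monomials of all non-faces. -/
noncomputable def srIdeal : Ideal (MvPolynomial V 𝕜) :=
  Ideal.span {m | ∃ σ : Finset V, σ ∉ K ∧ m = ∏ v ∈ σ, MvPolynomial.X v}

/-- The Stanley--Reisner ring `𝕜[K]`. -/
abbrev SRRing := MvPolynomial V 𝕜 ⧸ srIdeal 𝕜 K

/-- The homogeneous component of degree `i` of `𝕜[K]`: the classes of the homogeneous polynomials
of degree `i`. -/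
noncomputable def srComponent (i : ℕ) : Submodule 𝕜 (SRRing 𝕜 K) :=
  (MvPolynomial.homogeneousSubmodule V 𝕜 i).map
    (Ideal.Quotient.mkₐ 𝕜 (srIdeal 𝕜 K)).toLinearMap

variable {K} {G : Type*} [Group G] (A : ComplexAction G K)

theorem srIdeal_le_comap (g : G) :
    srIdeal 𝕜 K ≤ (srIdeal 𝕜 K).comap (MvPolynomial.rename (R := 𝕜) (A.toPerm g)) := by
  refine Ideal.span_le.2 ?_
  rintro _ ⟨σ, hσ, rfl⟩
  refine Ideal.subset_span ⟨finsetPerm A.toPerm g σ, fun h => hσ ?_, ?_⟩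
  · have := A.map_mem g⁻¹ _ h
    rwa [← Equiv.Perm.mul_apply, ← map_mul, inv_mul_cancel, map_one] at this
  · simp [finsetPerm, map_prod]

/-- The automorphism of `𝕜[K]` with `x_v ↦ x_{gv}`. -/
noncomputable def srAlgHom (g : G) : SRRing 𝕜 K →ₐ[𝕜] SRRing 𝕜 K :=
  Ideal.quotientMapₐ (srIdeal 𝕜 K) (MvPolynomial.rename (A.toPerm g)) (srIdeal_le_comap 𝕜 A g)

/-- The representation of `G` on `𝕜[K]`. -/
noncomputable def srRep : Representation 𝕜 G (SRRing 𝕜 K) where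
  toFun g := (srAlgHom 𝕜 A g).toLinearMap
  map_one' := by
    refine LinearMap.ext fun x => ?_
    obtain ⟨p, rfl⟩ := Ideal.Quotient.mk_surjective x
    change Ideal.Quotient.mk _ (MvPolynomial.rename (A.toPerm 1) p) = Ideal.Quotient.mk _ p
    rw [map_one, Equiv.Perm.coe_one, MvPolynomial.rename_id_apply]
  map_mul' g h := by
    refine LinearMap.ext fun x => ?_
    obtain ⟨p, rfl⟩ := Ideal.Quotient.mk_surjective x
    change Ideal.Quotient.mk _ (MvPolynomial.rename (A.toPerm (g * h)) p) =
      Ideal.Quotient.mk _ (MvPolynomial.rename (A.toPerm g) (MvPolynomial.rename (A.toPerm h) p))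
    rw [map_mul, Equiv.Perm.coe_mul, MvPolynomial.rename_rename]

theorem srComponent_le_comap (i : ℕ) (g : G) :
    srComponent 𝕜 K i ≤ (srComponent 𝕜 K i).comap (srRep 𝕜 A g) := by
  rintro _ ⟨p, hp, rfl⟩
  exact ⟨MvPolynomial.rename (A.toPerm g) p,
    MvPolynomial.IsHomogeneous.rename_isHomogeneous hp, rfl⟩

/-- The equivariant Hilbert series `∑ᵢ χ_{𝕜[K]ᵢ} tⁱ`, a power series whose coefficients are
functions on `G`. -/
noncomputable def eqHilb : PowerSeries (G → 𝕜) :=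
  PowerSeries.mk fun i =>
    ((srRep 𝕜 A).subrepresentation (srComponent 𝕜 K i) (srComponent_le_comap 𝕜 A i)).character

end StanleyReisner

/-! ### Equivariant `h`-vector and flag `h`-vector -/

section HVectors

variable {V : Type*} {K : FaceComplex V} {G : Type*} [Group G] (A : ComplexAction G K)

theorem card_finsetPerm (φ : G →* Equiv.Perm V) (g : G) (σ : Finset V) :
    (finsetPerm φ g σ).card = σ.card := by
  simp [finsetPerm]

/-- `fChar A i` is the character of the permutation representation on the faces with `i`
elements, that is, on the faces of dimension `i - 1`. -/
noncomputable def fChar (i : ℕ) : G → ℂ :=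
  permChar (finsetPerm A.toPerm) {σ | σ ∈ K ∧ σ.card = i}
    fun g σ hσ => ⟨A.map_mem g σ hσ.1, (card_finsetPerm A.toPerm g σ).trans hσ.2⟩

/-- The maximal cardinality of a face, that is, `dim K + 1` (for finite `V`). -/
noncomputable def maxFaceCard (K : FaceComplex V) : ℕ :=
  sSup {n | ∃ σ ∈ K, σ.card = n}

/-- The `k`-th entry of the equivariant `h`-vector; it vanishes for `k > dim K + 1`. -/
noncomputable def hChar (k : ℕ) : G → ℂ :=
  ∑ i ∈ Finset.range (k + 1),
    (-1) ^ (k - i) * ((maxFaceCard K - i).choose (k - i) : G → ℂ) * fChar A i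

variable {Γ : Type*} (γ : ProperColoring K Γ)

theorem color_finsetPerm (hγ : A.Preserves γ) (g : G) (σ : Finset V) :
    γ.color '' (finsetPerm A.toPerm g σ : Set V) = γ.color '' (σ : Set V) := by
  simp only [finsetPerm, MonoidHom.coe_mk, OneHom.coe_mk, Equiv.finsetCongr_apply,
    Finset.coe_map, Set.image_image]
  exact Set.image_congr fun v _ => hγ g v

variable (hγ : A.Preserves γ)

/-- The character of the permutation representation on the faces whose set of colors is `S`. -/
noncomputable def flagFChar (S : Finset Γ) : G → ℂ :=
  permChar (finsetPerm A.toPerm) {σ | σ ∈ K ∧ γ.color '' (σ : Set V) = S}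
    fun g σ hσ => ⟨A.map_mem g σ hσ.1, (color_finsetPerm A γ hγ g σ).trans hσ.2⟩

/-- The entry at `S` of the equivariant flag `h`-vector. -/
noncomputable def flagHChar (S : Finset Γ) : G → ℂ :=
  ∑ T ∈ S.powerset, (-1) ^ (S.card - T.card) * flagFChar A γ hγ T

/-- The color-selected subcomplex `K|_S` of the faces all of whose colors lie in `S`. -/
def colorSelect (S : Finset Γ) : FaceComplex V where
  carrier := {σ | σ ∈ K ∧ ∀ v ∈ σ, γ.color v ∈ S}
  lower' _ _ hτ hσ := ⟨K.lower hτ hσ.1, fun v hv => hσ.2 v (hτ hv)⟩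

/-- The coloring of `K|_S` inherited from `K`. -/
def ProperColoring.select (S : Finset Γ) : ProperColoring (colorSelect γ S) Γ where
  color := γ.color
  injOn σ hσ := γ.injOn σ hσ.1

/-- The action on `K|_S` inherited from a color-preserving action on `K`. -/
def ComplexAction.select (S : Finset Γ) : ComplexAction G (colorSelect γ S) where
  toPerm := A.toPerm
  map_mem g σ hσ := by
    refine ⟨A.map_mem g σ hσ.1, fun v hv => ?_⟩
    obtain ⟨w, hw, rfl⟩ := Finset.mem_map.1 hv
    simpa [hγ g w] using hσ.2 w hw

end HVectors

/-! ### Reduced simplicial homology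

The simplices are oriented by listing their vertices in the order of their colors. A
color-preserving action then permutes the oriented simplices. -/

section Homology

variable (𝕜 : Type*) [Field 𝕜] {V Γ : Type*} [LinearOrder Γ] {K : FaceComplex V} (γ : ProperColoring K Γ)

open scoped Classical in
/-- The (augmented) boundary map: `e_σ ↦ ∑ⱼ (-1)ʲ e_{σ ∖ vⱼ}` for `σ = {v₀ ≺ v₁ ≺ ⋯}`; the
position of `v` in `σ` is the number of vertices of `σ` of smaller color. -/
noncomputable def boundary : (Finset V →₀ 𝕜) →ₗ[𝕜] (Finset V →₀ 𝕜) :=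
  Finsupp.linearCombination 𝕜 fun σ : Finset V =>
    ∑ v ∈ σ, Finsupp.single (σ.erase v)
      ((-1 : 𝕜) ^ (σ.filter fun u => γ.color u < γ.color v).card)

/-- The chains spanned by the faces with `n` elements: chains of degree `n - 1`. -/
def chainSpace (K : FaceComplex V) (n : ℕ) : Submodule 𝕜 (Finset V →₀ 𝕜) :=
  Finsupp.supported 𝕜 𝕜 {σ | σ ∈ K ∧ σ.card = n}

/-- The reduced cycles of degree `n - 1`. -/
noncomputable def cycleSpace (n : ℕ) : Submodule 𝕜 (Finset V →₀ 𝕜) :=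
  chainSpace 𝕜 K n ⊓ LinearMap.ker (boundary 𝕜 γ)

/-- The boundaries of degree `n - 1`. -/
noncomputable def boundarySpace (n : ℕ) : Submodule 𝕜 (Finset V →₀ 𝕜) :=
  (chainSpace 𝕜 K (n + 1)).map (boundary 𝕜 γ)

/-- The reduced simplicial homology of `K` **in degree `n - 1`**, with coefficients in the
field `𝕜`: cycles modulo boundaries. -/
abbrev ReducedHomology (n : ℕ) :=
  SubQuotient (cycleSpace 𝕜 γ n) (boundarySpace 𝕜 γ n)

variable {G : Type*} [Group G] (A : ComplexAction G K)

theorem chainSpace_le_comap (n : ℕ) (g : G) :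
    chainSpace 𝕜 K n ≤ (chainSpace 𝕜 K n).comap (permRep 𝕜 (finsetPerm A.toPerm) g) := by
  classical
  intro x hx
  rw [Submodule.mem_comap, chainSpace, Finsupp.mem_supported]
  intro τ hτ
  obtain ⟨σ, hσ, rfl⟩ := Finset.mem_image.1 (Finsupp.mapDomain_support hτ)
  have h := (Finsupp.mem_supported 𝕜 x).1 hx hσ
  exact ⟨A.map_mem g σ h.1, (card_finsetPerm A.toPerm g σ).trans h.2⟩

theorem boundary_permRep (hγ : A.Preserves γ) (g : G) (x : Finset V →₀ 𝕜) :
    boundary 𝕜 γ (permRep 𝕜 (finsetPerm A.toPerm) g x) =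
      permRep 𝕜 (finsetPerm A.toPerm) g (boundary 𝕜 γ x) := by
  classical
  induction x using Finsupp.induction_linear with
  | zero => simp
  | add x y hx hy => simp [hx, hy]
  | single σ c =>
    simp only [permRep, MonoidHom.coe_mk, OneHom.coe_mk, Finsupp.lmapDomain_apply,
      Finsupp.mapDomain_single, boundary, Finsupp.linearCombination_single, map_smul,
      Finsupp.mapDomain_finsetSum]
    congr 1
    simp only [finsetPerm, MonoidHom.coe_mk, OneHom.coe_mk, Equiv.finsetCongr_apply,
      Finset.sum_map, Finset.map_erase, Finset.filter_map, Finset.card_map]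
    refine Finset.sum_congr rfl fun v _ => ?_
    congr 3
    refine Finset.filter_congr fun u _ => ?_
    simp [hγ g u, hγ g v]

theorem cycleSpace_le_comap (hγ : A.Preserves γ) (n : ℕ) (g : G) :
    cycleSpace 𝕜 γ n ≤ (cycleSpace 𝕜 γ n).comap (permRep 𝕜 (finsetPerm A.toPerm) g) := by
  rintro x ⟨hx, hx'⟩
  refine ⟨chainSpace_le_comap 𝕜 A n g hx, ?_⟩
  have hx'' : boundary 𝕜 γ x = 0 := hx'
  change boundary 𝕜 γ _ = 0
  rw [boundary_permRep 𝕜 γ A hγ, hx'', map_zero]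

theorem boundarySpace_le_comap (hγ : A.Preserves γ) (n : ℕ) (g : G) :
    boundarySpace 𝕜 γ n ≤ (boundarySpace 𝕜 γ n).comap (permRep 𝕜 (finsetPerm A.toPerm) g) := by
  rintro _ ⟨y, hy, rfl⟩
  exact ⟨permRep 𝕜 (finsetPerm A.toPerm) g y, chainSpace_le_comap 𝕜 A (n + 1) g hy,
    boundary_permRep 𝕜 γ A hγ g y⟩

/-- The representation of `G` on the reduced homology of `K` in degree `n - 1`. -/
noncomputable def homologyRep (hγ : A.Preserves γ) (n : ℕ) :
    Representation 𝕜 G (ReducedHomology 𝕜 γ n) :=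
  subQuotientRep (permRep 𝕜 (finsetPerm A.toPerm)) (cycleSpace 𝕜 γ n) (boundarySpace 𝕜 γ n)
    (cycleSpace_le_comap 𝕜 γ A hγ n) (boundarySpace_le_comap 𝕜 γ A hγ n)

end Homology

/-! ### Equivariant Ehrhart series -/

section Ehrhart

variable {G E : Type*} [Group G] [AddCommGroup E] [Module ℝ E] (ρ : G →* (E ≃ₗ[ℝ] E))

/-- The permutations of the points of `E` given by a linear action. -/
def pointPerm : G →* Equiv.Perm E where
  toFun g := (ρ g).toEquiv
  map_one' := by ext; simp
  map_mul' g h := by ext; simp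

theorem latticePoints_invariant (M : AddSubgroup E) (hM : ∀ g, ∀ v ∈ M, ρ g v ∈ M)
    (P : Set E) (hP : ∀ g, ρ g '' P = P) (m : ℕ) (g : G) (v : E) (hv : v ∈ ((m : ℝ) • P) ∩ (M : Set E)) :
    pointPerm ρ g v ∈ ((m : ℝ) • P) ∩ (M : Set E) := by
  obtain ⟨⟨p, hp, rfl⟩, hv⟩ := hv
  refine ⟨⟨ρ g p, ?_, ?_⟩, hM g _ hv⟩
  · rw [← hP g]
    exact ⟨p, hp, rfl⟩
  · simp [pointPerm]

/-- The equivariant Ehrhart series `1 + ∑_{m ≥ 1} χ_{mP} t^m` of a `G`-invariant lattice polytope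
`P` with respect to the `G`-invariant lattice `M`, for a linear action `ρ` of `G`; here `χ_{mP}` is
the character of the permutation representation on `mP ∩ M`. -/
noncomputable def eqEhr (M : AddSubgroup E) (hM : ∀ g, ∀ v ∈ M, ρ g v ∈ M)
    (P : Set E) (hP : ∀ g, ρ g '' P = P) : PowerSeries (G → ℂ) :=
  PowerSeries.mk fun m =>
    if m = 0 then 1
    else permChar (pointPerm ρ) (((m : ℝ) • P) ∩ (M : Set E))
      (latticePoints_invariant ρ M hM P hP m)

end Ehrhart

/-! ### Order polytopes and order complexes -/

section OrderPolytope

/-- The order polytope of `X`. -/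
def orderPolytope (X : Type*) [PartialOrder X] : Set (X → ℝ) :=
  {f | ∀ x x', x ≤ x' → 0 ≤ f x ∧ f x ≤ f x' ∧ f x' ≤ 1}

/-- The lattice `ℤ^X` in `ℝ^X`. -/
def intLattice (X : Type*) : AddSubgroup (X → ℝ) where
  carrier := {f | ∀ x, ∃ n : ℤ, f x = n}
  zero_mem' x := ⟨0, by simp⟩
  add_mem' {f f'} hf hf' x := by
    obtain ⟨n, hn⟩ := hf x
    obtain ⟨n', hn'⟩ := hf' x
    exact ⟨n + n', by simp [hn, hn']⟩
  neg_mem' {f} hf x := by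
    obtain ⟨n, hn⟩ := hf x
    exact ⟨-n, by simp [hn]⟩

/-- The order complex of a poset: the complex of its finite chains. -/
def orderComplex (Q : Type*) [PartialOrder Q] : FaceComplex Q where
  carrier := {σ | IsChain (· ≤ ·) (σ : Set Q)}
  lower' _ _ hτ hσ := IsChain.mono (Finset.coe_subset.2 hτ) hσ

variable {X G : Type*} [PartialOrder X] [Group G] (a : G →* (X ≃o X))

/-- The permutation representation on `ℝ^X`: `g` maps `f` to `f ∘ g⁻¹`. -/
def coordRep : G →* ((X → ℝ) ≃ₗ[ℝ] (X → ℝ)) where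
  toFun g := LinearEquiv.funCongrLeft ℝ ℝ (a g⁻¹).toEquiv
  map_one' := by ext; simp
  map_mul' g h := by ext; simp

theorem coordRep_intLattice (g : G) (f : X → ℝ) (hf : f ∈ intLattice X) :
    coordRep a g f ∈ intLattice X :=
  fun x => hf (a g⁻¹ x)

/-- The action on the order complex of `J(X)`, the poset of lower order ideals of `X` ordered by
inclusion: `g` maps an order ideal `J` to its image `gJ`. -/
def idealAction : ComplexAction G (orderComplex (LowerSet X)) where
  toPerm :=
    { toFun := fun g => (LowerSet.map (a g)).toEquiv
      map_one' := by ext; simp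
      map_mul' := fun g h => by ext; simp }
  map_mem g σ hσ := by
    intro I' hI' J' hJ' _
    obtain ⟨I, hI, rfl⟩ := Finset.mem_map.1 (Finset.mem_coe.1 hI')
    obtain ⟨J, hJ, rfl⟩ := Finset.mem_map.1 (Finset.mem_coe.1 hJ')
    exact (hσ.total hI hJ).imp (fun h => (LowerSet.map (a g)).monotone h)
      (fun h => (LowerSet.map (a g)).monotone h)

/-- The standard coloring of the order complex of `J(X)`: the color of an order ideal is its rank,
that is, its cardinality. -/
noncomputable def rankColoring (X : Type*) [PartialOrder X] [Finite X] :
    ProperColoring (orderComplex (LowerSet X)) ℕ where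
  color J := (J : Set X).ncard
  injOn σ hσ I hI J hJ h := by
    rcases hσ.total hI hJ with hIJ | hJI
    · exact SetLike.coe_injective (Set.eq_of_subset_of_ncard_le hIJ h.ge (Set.toFinite _))
    · exact SetLike.coe_injective (Set.eq_of_subset_of_ncard_le hJI h.le (Set.toFinite _)).symm

theorem idealAction_preserves [Finite X] : (idealAction a).Preserves (rankColoring X) := by
  intro g J
  exact Set.ncard_image_of_injective (J : Set X) (a g).injective

end OrderPolytope

/-! A degree-`m` monomial of `ℂ[Δ]` supported on a face is a multichain of `m` order ideals.
Counting, for each `x`, the members that omit `x` gives an order-preserving map from `X` to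
`{0,…,m}`, that is, a lattice point of the `m`-th dilate of the order polytope. This is an
equivariant bijection (`height_bijOn`, `height_monomialPerm`), and the face monomials form a
permuted basis of each graded piece (`coeff_eqHilb`), so the Ehrhart and Hilbert series agree.

Since `g` preserves ranks, a `g`-invariant chain is fixed vertex by vertex. Hence the Hilbert series
at `g` is the sum of `(t/(1-t))^|σ|` over the invariant chains (`map_eqHilb`). The binomial identity
`sum_flagTransform_mul_pow` rewrites it through the flag `h`-vector. The ideals `∅` and `X` are cone
points, which kills every entry whose rank set contains `0` or `d` (`flagHChar_eq_zero`). Counting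
the supersets of given size of a rank set shows that the flag `h`-vector refines the `h`-vector.

For homology, fix a linear extension `ω` of `X`. A chain of ideals cuts `X` into successive blocks;
sorting each block by `ω` gives a linear extension `π`. The chains in `Δ|_S` with a given `π`
consist of initial segments of `π` and contain those at all descents of `π`. If one of them misses a
rank `s ∈ S`, then `s` is not a descent, so the segment of size `s` can be added to or removed from
every chain of the class (`exists_toggle`). The inversion set of `π` grows with the chain, so
filtering by it and toggling kills all homology below the top degree
(`cycleSpace_le_boundarySpace`). The Hopf trace formula (`homologyRep_character`) then identifies
the flag `h`-entry with the character of top homology, whence effectiveness. -/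

/-! ### Traces and characters -/

/-- Additivity of the trace along a short exact sequence `0 → A → V → W → 0`. -/
theorem trace_eq_add_of_exact {𝕜 A V W : Type*} [Field 𝕜] [AddCommGroup A] [Module 𝕜 A]
    [AddCommGroup V] [Module 𝕜 V] [AddCommGroup W] [Module 𝕜 W] [FiniteDimensional 𝕜 V]
    (i : A →ₗ[𝕜] V) (p : V →ₗ[𝕜] W) (hi : Function.Injective i) (hp : Function.Surjective p)
    (hip : Function.Exact i p) (TA : A →ₗ[𝕜] A) (T : V →ₗ[𝕜] V) (TW : W →ₗ[𝕜] W)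
    (hA : ∀ x, T (i x) = i (TA x)) (hW : ∀ x, p (T x) = TW (p x)) :
    LinearMap.trace 𝕜 V T = LinearMap.trace 𝕜 A TA + LinearMap.trace 𝕜 W TW := by
  have : FiniteDimensional 𝕜 A := FiniteDimensional.of_injective i hi
  have : FiniteDimensional 𝕜 W := Module.Finite.of_surjective p hp
  obtain ⟨s, hs⟩ := p.exists_rightInverse_of_surjective (LinearMap.range_eq_top.2 hp)
  obtain ⟨r, hr⟩ := i.exists_leftInverse_of_injective (LinearMap.ker_eq_bot.2 hi)
  have hs' : ∀ x, p (s x) = x := fun x => LinearMap.congr_fun hs x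
  have hr' : ∀ x, r (i x) = x := fun x => LinearMap.congr_fun hr x
  have hpi : ∀ x, p (i x) = 0 := fun x => (hip _).2 ⟨x, rfl⟩
  have hq : ∀ v, i (r (v - s (p v))) = v - s (p v) := by
    intro v
    obtain ⟨x, hx⟩ := (hip (v - s (p v))).1 (by simp [hs'])
    rw [← hx, hr']
  let q : V →ₗ[𝕜] A := r ∘ₗ (LinearMap.id - s ∘ₗ p)
  -- The section `s` and the retraction `r` split `T` into maps factoring through `A` and through
  -- `W`; commuting the factors under the trace leaves `TA` and `TW`.
  have hT : T = (T ∘ₗ i) ∘ₗ q + (T ∘ₗ s) ∘ₗ p := by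
    ext v
    have := hq v
    simp only [q, LinearMap.add_apply, LinearMap.comp_apply, LinearMap.sub_apply,
      LinearMap.id_apply]
    rw [this, ← map_add, sub_add_cancel]
  have h1 : q ∘ₗ (T ∘ₗ i) = TA := by
    ext x
    simp [q, hA, hpi, hr']
  have h2 : p ∘ₗ (T ∘ₗ s) = TW := by
    ext x
    simp [hW, hs']
  rw [hT, map_add, LinearMap.trace_comp_comm' q (T ∘ₗ i), LinearMap.trace_comp_comm' p (T ∘ₗ s),
    h1, h2]

theorem trace_eq_of_linearEquiv {𝕜 V W : Type*} [Field 𝕜] [AddCommGroup V] [Module 𝕜 V]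
    [AddCommGroup W] [Module 𝕜 W] (e : V ≃ₗ[𝕜] W) (T : V →ₗ[𝕜] V) (U : W →ₗ[𝕜] W)
    (h : ∀ x, e (T x) = U (e x)) : LinearMap.trace 𝕜 V T = LinearMap.trace 𝕜 W U := by
  rw [← LinearMap.trace_conj' T e]
  congr 1
  ext x
  simp [LinearEquiv.conj_apply, h]

theorem permRep_single (𝕜 : Type*) [Field 𝕜] {G Y : Type*} [Group G] (φ : G →* Equiv.Perm Y)
    (g : G) (y : Y) (c : 𝕜) : permRep 𝕜 φ g (Finsupp.single y c) = Finsupp.single (φ g y) c := by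
  simp [permRep]

theorem permRep_character {G Y : Type*} [Group G] [Finite Y] (φ : G →* Equiv.Perm Y) (g : G) :
    (permRep ℂ φ).character g = ({y | φ g y = y} : Set Y).ncard := by
  classical
  cases nonempty_fintype Y
  rw [Representation.character, LinearMap.trace_eq_matrix_trace ℂ Finsupp.basisSingleOne,
    Matrix.trace, Set.ncard_eq_toFinset_card', Finset.card_eq_sum_ones, Nat.cast_sum,
    Set.toFinset_ofPred, Finset.sum_filter]
  refine Finset.sum_congr rfl fun y _ => ?_
  simp [LinearMap.toMatrix_apply, permRep_single, Finsupp.single_apply]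

/-- A permutation matrix has trace its number of fixed points; this turns character identities at a
fixed `g` into counts of invariant objects. -/
theorem permChar_apply {G Y : Type*} [Group G] (φ : G →* Equiv.Perm Y) (A : Set Y)
    (hA : ∀ g, ∀ y ∈ A, φ g y ∈ A) (hfin : A.Finite) (g : G) :
    permChar φ A hA g = ({y | y ∈ A ∧ φ g y = y} : Set Y).ncard := by
  have := hfin.to_subtype
  rw [permChar, permRep_character, ← Set.ncard_image_of_injective _ Subtype.val_injective]
  congr 2
  ext y
  constructor
  · rintro ⟨z, hz, rfl⟩
    exact ⟨z.2, congrArg Subtype.val hz⟩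
  · rintro ⟨hy, h⟩
    exact ⟨⟨y, hy⟩, Subtype.ext h, rfl⟩

theorem permChar_congr {G Y Y' : Type*} [Group G] (φ : G →* Equiv.Perm Y)
    (ψ : G →* Equiv.Perm Y') (A : Set Y) (B : Set Y') (hA : ∀ g, ∀ y ∈ A, φ g y ∈ A)
    (hB : ∀ g, ∀ y ∈ B, ψ g y ∈ B) (f : Y → Y') (hf : Set.BijOn f A B)
    (h : ∀ g, ∀ y ∈ A, f (φ g y) = ψ g (f y)) : permChar φ A hA = permChar ψ B hB := by
  ext g
  let e : A ≃ B := hf.equiv f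
  refine trace_eq_of_linearEquiv (Finsupp.domLCongr e) _ _ fun x => ?_
  induction x using Finsupp.induction_linear with
  | zero => simp
  | add x y hx hy => rw [map_add, map_add, map_add, map_add, hx, hy]
  | single y c =>
    rw [permRep_single, Finsupp.domLCongr_single, Finsupp.domLCongr_single, permRep_single]
    congr 1
    exact Subtype.ext (h g y y.2)

/-- The subrepresentation of a permutation representation supported on an invariant set affords
the corresponding permutation character. -/
theorem character_supported {G Y : Type*} [Group G] (φ : G →* Equiv.Perm Y) (A : Set Y)
    (hA : ∀ g, ∀ y ∈ A, φ g y ∈ A)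
    (h : ∀ g, Finsupp.supported ℂ ℂ A ≤ (Finsupp.supported ℂ ℂ A).comap (permRep ℂ φ g)) :
    ((permRep ℂ φ).subrepresentation (Finsupp.supported ℂ ℂ A) h).character =
      permChar φ A hA := by
  ext g
  refine (trace_eq_of_linearEquiv (Finsupp.supportedEquivFinsupp (M := ℂ) (R := ℂ) A).symm _ _
    fun x => ?_).symm
  induction x using Finsupp.induction_linear with
  | zero => simp
  | add x y hx hy => simp [hx, hy]
  | single y c =>
    refine Subtype.ext ?_
    rw [permRep_single, Finsupp.supportedEquivFinsupp_symm_single]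
    change _ = permRep ℂ φ g _
    rw [Submodule.subtype_apply,
      Finsupp.supportedEquivFinsupp_symm_single, permRep_single]
    rfl

theorem isEffective_of_representation {G V : Type*} [Group G] [AddCommGroup V] [Module ℂ V]
    [FiniteDimensional ℂ V] (τ : Representation ℂ G V) : IsEffective τ.character := by
  let e : V ≃ₗ[ℂ] (Fin (Module.finrank ℂ V) → ℂ) := (Module.finBasis ℂ V).equivFun
  refine ⟨Module.finrank ℂ V, ⟨⟨fun g => e.conj (τ g), ?_⟩, ?_⟩, ?_⟩
  · ext; simp [LinearEquiv.conj_apply]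
  · intro g h
    ext; simp [LinearEquiv.conj_apply]
  · ext g
    exact LinearMap.trace_conj' (τ g) e

theorem isEffective_zero {G : Type*} [Group G] : IsEffective (0 : G → ℂ) := by
  refine ⟨0, 1, ?_⟩
  ext g
  simp [Representation.character]

theorem IsEffective.add {G : Type*} [Group G] {χ ψ : G → ℂ} (hχ : IsEffective χ)
    (hψ : IsEffective ψ) : IsEffective (χ + ψ) := by
  obtain ⟨n, τ, rfl⟩ := hχ
  obtain ⟨m, υ, rfl⟩ := hψ
  convert isEffective_of_representation (τ.prod υ) using 1
  ext g
  exact (LinearMap.trace_prodMap' (τ g) (υ g)).symm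

theorem isEffective_sum {G ι : Type*} [Group G] (s : Finset ι) (χ : ι → G → ℂ)
    (h : ∀ i ∈ s, IsEffective (χ i)) : IsEffective (∑ i ∈ s, χ i) := by
  classical
  induction s using Finset.induction_on with
  | empty => exact isEffective_zero
  | insert i s hi ih =>
    rw [Finset.sum_insert hi]
    exact (h i (Finset.mem_insert_self i s)).add
      (ih fun j hj => h j (Finset.mem_insert_of_mem hj))

/-! ### The boundary map -/

section BoundaryMap

open scoped Classical in
/-- The sign of the facet `σ ∖ v` in the boundary of `σ`. -/
noncomputable def faceSign (𝕜 : Type*) [Field 𝕜] {V Γ : Type*} [LinearOrder Γ]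
    {K : FaceComplex V} (γ : ProperColoring K Γ) (σ : Finset V) (v : V) : 𝕜 :=
  (-1 : 𝕜) ^ (σ.filter fun u => γ.color u < γ.color v).card

variable (𝕜 : Type*) [Field 𝕜] {V Γ : Type*} [LinearOrder Γ] {K : FaceComplex V}
  (γ : ProperColoring K Γ)

theorem faceSign_mul_self (σ : Finset V) (v : V) :
    faceSign 𝕜 γ σ v * faceSign 𝕜 γ σ v = 1 := by
  rw [faceSign, ← pow_add, Even.neg_one_pow ⟨_, rfl⟩]

theorem faceSign_ne_zero (σ : Finset V) (v : V) : faceSign 𝕜 γ σ v ≠ 0 :=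
  left_ne_zero_of_mul_eq_one (faceSign_mul_self 𝕜 γ σ v)

open scoped Classical in
theorem faceSign_erase_of_lt {σ : Finset V} {u v : V} (h : γ.color u < γ.color v) :
    faceSign 𝕜 γ (σ.erase v) u = faceSign 𝕜 γ σ u := by
  rw [faceSign, faceSign, Finset.filter_erase, Finset.erase_eq_of_notMem]
  simp [h.le]

open scoped Classical in
theorem faceSign_erase_of_gt {σ : Finset V} {u v : V} (hu : u ∈ σ) (h : γ.color u < γ.color v) :
    faceSign 𝕜 γ (σ.erase u) v = -faceSign 𝕜 γ σ v := by
  have hmem : u ∈ σ.filter fun w => γ.color w < γ.color v := by simp [hu, h]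
  rw [faceSign, faceSign, Finset.filter_erase, ← Finset.card_erase_add_one hmem, pow_succ,
    mul_neg_one, neg_neg]

open scoped Classical in
theorem boundary_single (σ : Finset V) (c : 𝕜) :
    boundary 𝕜 γ (Finsupp.single σ c) =
      ∑ v ∈ σ, Finsupp.single (σ.erase v) (c * faceSign 𝕜 γ σ v) := by
  simp [boundary, Finsupp.linearCombination_single, Finset.smul_sum, faceSign]

-- The transposed form of the boundary: the coefficient at `τ` collects contributions from the faces
-- covering `τ`. The vanishing criterion compares coefficients in this form.
open scoped Classical in
theorem boundary_apply [Fintype V] (x : Finset V →₀ 𝕜) (τ : Finset V) :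
    boundary 𝕜 γ x τ = ∑ u ∈ τᶜ, faceSign 𝕜 γ (insert u τ) u * x (insert u τ) := by
  induction x using Finsupp.induction_linear with
  | zero => simp
  | add x y hx hy => simp [hx, hy, mul_add, Finset.sum_add_distrib]
  | single σ c =>
    rw [boundary_single, Finsupp.finsetSum_apply]
    simp only [Finsupp.single_apply, mul_ite, mul_zero]
    rw [← Finset.sum_filter, ← Finset.sum_filter]
    have : σ.filter (fun v => σ.erase v = τ) = τᶜ.filter fun u => σ = insert u τ := by
      ext v
      simp only [Finset.mem_filter, Finset.mem_compl]
      constructor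
      · rintro ⟨hv, rfl⟩
        exact ⟨Finset.notMem_erase v σ, (Finset.insert_erase hv).symm⟩
      · rintro ⟨hv, rfl⟩
        exact ⟨Finset.mem_insert_self v τ, Finset.erase_insert hv⟩
    rw [this]
    refine Finset.sum_congr rfl fun v hv => ?_
    rw [← (Finset.mem_filter.1 hv).2, mul_comm]

/-- Removing two vertices in either order gives opposite signs, because deleting the vertex of
smaller color shifts the position of the other by one. That `σ` is a face guarantees distinct
colors. -/
theorem boundary_boundary_single {σ : Finset V} (hσ : σ ∈ K) (c : 𝕜) :
    boundary 𝕜 γ (boundary 𝕜 γ (Finsupp.single σ c)) = 0 := by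
  classical
  rw [boundary_single, map_sum]
  simp only [boundary_single]
  rw [Finset.sum_sigma']
  refine Finset.sum_involution (fun p _ => ⟨p.2, p.1⟩) ?_ ?_ ?_ ?_
  · rintro ⟨v, u⟩ hp
    obtain ⟨hv, hu⟩ : v ∈ σ ∧ u ≠ v ∧ u ∈ σ := by simpa using hp
    obtain ⟨huv, hu⟩ := hu
    have hc : γ.color u ≠ γ.color v := fun h => huv (γ.injOn σ hσ hu hv h)
    dsimp only
    rw [Finset.erase_right_comm (a := u) (b := v), ← Finsupp.single_add, Finsupp.single_eq_zero]
    rcases hc.lt_or_gt with h | h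
    · rw [faceSign_erase_of_lt 𝕜 γ h, faceSign_erase_of_gt 𝕜 γ hu h]
      ring
    · rw [faceSign_erase_of_lt 𝕜 γ h, faceSign_erase_of_gt 𝕜 γ hv h]
      ring
  · rintro ⟨v, u⟩ hp _ h
    obtain ⟨hv, huv, hu⟩ : v ∈ σ ∧ u ≠ v ∧ u ∈ σ := by simpa using hp
    exact huv (congrArg Sigma.fst h)
  · rintro ⟨v, u⟩ hp
    obtain ⟨hv, huv, hu⟩ : v ∈ σ ∧ u ≠ v ∧ u ∈ σ := by simpa using hp
    simp [hv, hu, huv.symm]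
  · intros
    rfl

theorem mem_chainSpace {n : ℕ} {x : Finset V →₀ 𝕜} :
    x ∈ chainSpace 𝕜 K n ↔ ∀ σ, x σ ≠ 0 → σ ∈ K ∧ σ.card = n := by
  rw [chainSpace, Finsupp.mem_supported]
  simp [Set.subset_def]

theorem chainSpace_induction {n : ℕ} {p : (Finset V →₀ 𝕜) → Prop} (zero : p 0)
    (add : ∀ x y, p x → p y → p (x + y))
    (single : ∀ σ ∈ K, σ.card = n → ∀ c, p (Finsupp.single σ c)) {x : Finset V →₀ 𝕜}
    (hx : x ∈ chainSpace 𝕜 K n) : p x := by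
  have hx' := (mem_chainSpace 𝕜).1 hx
  rw [← Finsupp.sum_single x]
  refine Finset.sum_induction _ p add zero fun σ hσ => ?_
  obtain ⟨h, h'⟩ := hx' σ (Finsupp.mem_support_iff.1 hσ)
  exact single σ h h' _

theorem boundary_boundary {n : ℕ} {x : Finset V →₀ 𝕜} (hx : x ∈ chainSpace 𝕜 K n) :
    boundary 𝕜 γ (boundary 𝕜 γ x) = 0 :=
  chainSpace_induction 𝕜 (p := fun x => boundary 𝕜 γ (boundary 𝕜 γ x) = 0) (by simp)
    (fun x y hx hy => by simp [hx, hy])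
    (fun σ hσ _ c => boundary_boundary_single 𝕜 γ hσ c) hx

theorem boundary_mem_chainSpace {n : ℕ} {x : Finset V →₀ 𝕜} (hx : x ∈ chainSpace 𝕜 K (n + 1)) :
    boundary 𝕜 γ x ∈ chainSpace 𝕜 K n := by
  classical
  refine chainSpace_induction 𝕜 (p := fun x => boundary 𝕜 γ x ∈ chainSpace 𝕜 K n) (by simp)
    (fun x y hx hy => by rw [map_add]; exact add_mem hx hy) (fun σ hσ hn c => ?_) hx
  rw [boundary_single]
  refine Submodule.sum_mem _ fun v hv => ?_
  rw [mem_chainSpace]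
  intro τ hτ
  obtain rfl : σ.erase v = τ := by
    by_contra h
    exact hτ (Finsupp.single_eq_of_ne (Ne.symm h))
  exact ⟨K.lower (Finset.erase_subset v σ) hσ, by rw [Finset.card_erase_of_mem hv, hn]; rfl⟩

theorem boundarySpace_le_cycleSpace (n : ℕ) : boundarySpace 𝕜 γ n ≤ cycleSpace 𝕜 γ n := by
  rintro _ ⟨x, hx, rfl⟩
  exact ⟨boundary_mem_chainSpace 𝕜 γ hx, boundary_boundary 𝕜 γ hx⟩

theorem chainSpace_eq_bot {n : ℕ} (h : ∀ σ ∈ K, σ.card ≠ n) : chainSpace 𝕜 K n = ⊥ := by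
  rw [eq_bot_iff]
  intro x hx
  rw [mem_chainSpace] at hx
  refine (Submodule.mem_bot 𝕜).2 (Finsupp.ext fun σ => ?_)
  by_contra hσ
  exact h σ (hx σ hσ).1 (hx σ hσ).2

theorem subsingleton_reducedHomology {n : ℕ} (h : cycleSpace 𝕜 γ n ≤ boundarySpace 𝕜 γ n) :
    Subsingleton (ReducedHomology 𝕜 γ n) := by
  refine Submodule.Quotient.subsingleton_iff.2 ?_
  rw [Submodule.submoduleOf, Submodule.comap_subtype_eq_top]
  exact h

/-- A vanishing criterion for reduced homology. The faces are divided into classes by a monotone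
invariant `c`, and in each class that contains a face with `n` elements there is a vertex that can
be added to and removed from all faces of the class without leaving it. -/
theorem cycleSpace_le_boundarySpace [Finite V] {W : Type*} (c : Finset V → Finset W)
    (hc : ∀ τ σ, τ ⊆ σ → c τ ⊆ c σ) {n : ℕ} (v : Finset W → V)
    (hv : open scoped Classical in ∀ σ ∈ K, (∃ τ ∈ K, τ.card = n ∧ c τ = c σ) →
      insert (v (c σ)) σ ∈ K ∧ c (insert (v (c σ)) σ) = c σ ∧ c (σ.erase (v (c σ))) = c σ) :
    cycleSpace 𝕜 γ n ≤ boundarySpace 𝕜 γ n := by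
  classical
  cases nonempty_fintype V
  suffices H : ∀ m, ∀ z ∈ cycleSpace 𝕜 γ n, (∀ σ, z σ ≠ 0 → (c σ).card < m) →
      z ∈ boundarySpace 𝕜 γ n by
    intro z hz
    exact H ((z.support.sup fun σ => (c σ).card) + 1) z hz fun σ hσ => Nat.lt_succ_of_le
      (Finset.le_sup (f := fun σ => (c σ).card) (Finsupp.mem_support_iff.2 hσ))
  intro m
  induction m with
  | zero =>
    intro z _ hz
    have : z = 0 := Finsupp.ext fun σ => by
      by_contra h
      exact Nat.not_lt_zero _ (hz σ h)
    rw [this]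
    exact zero_mem _
  | succ m ih =>
    intro z hz hzm
    have hzK := (mem_chainSpace 𝕜).1 hz.1
    -- On level `m`, `w` cones each class off with its vertex `v`: the coefficient at `ρ` is that of
    -- `z` at `ρ ∖ v`, signed so that `∂w` reproduces `z` there.
    let w : Finset V →₀ 𝕜 := Finsupp.equivFunOnFinite.symm fun ρ =>
      if v (c ρ) ∈ ρ ∧ (c ρ).card = m ∧ c (ρ.erase (v (c ρ))) = c ρ ∧ ρ ∈ K then
        faceSign 𝕜 γ ρ (v (c ρ)) * z (ρ.erase (v (c ρ))) else 0
    have hw : ∀ ρ, w ρ =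
        if v (c ρ) ∈ ρ ∧ (c ρ).card = m ∧ c (ρ.erase (v (c ρ))) = c ρ ∧ ρ ∈ K then
        faceSign 𝕜 γ ρ (v (c ρ)) * z (ρ.erase (v (c ρ))) else 0 := fun ρ => rfl
    have hw0 : ∀ ρ, w ρ ≠ 0 → v (c ρ) ∈ ρ ∧ (c ρ).card = m ∧ ρ ∈ K ∧
        z (ρ.erase (v (c ρ))) ≠ 0 := by
      intro ρ h
      rw [hw] at h
      split_ifs at h with h'
      · exact ⟨h'.1, h'.2.1, h'.2.2.2, right_ne_zero_of_mul h⟩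
      · exact absurd rfl h
    have hwC : w ∈ chainSpace 𝕜 K (n + 1) := by
      rw [mem_chainSpace]
      intro ρ h
      obtain ⟨h1, _, h3, h4⟩ := hw0 ρ h
      exact ⟨h3, by rw [← (hzK _ h4).2, Finset.card_erase_add_one h1]⟩
    have hz' : z - boundary 𝕜 γ w ∈ cycleSpace 𝕜 γ n :=
      sub_mem hz (boundarySpace_le_cycleSpace 𝕜 γ n ⟨w, hwC, rfl⟩)
    have hz'K := (mem_chainSpace 𝕜).1 hz'.1
    -- `w` lives on level `m` and `c` is monotone, so `∂w` cannot reach above that level.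
    have hle : ∀ τ, (z - boundary 𝕜 γ w) τ ≠ 0 → (c τ).card ≤ m := by
      intro τ hτ
      by_contra! hm
      refine hτ ?_
      rw [Finsupp.sub_apply, boundary_apply, Finset.sum_eq_zero, sub_zero]
      · by_contra h
        exact absurd (hzm τ h) (by omega)
      · intro u _
        by_cases h : w (insert u τ) = 0
        · rw [h, mul_zero]
        · have := Finset.card_le_card (hc τ _ (Finset.subset_insert u τ))
          have := (hw0 _ h).2.1
          omega
    -- A face `τ ∪ {u}` in the support of `w` has the class of `τ` and so contains `v`; thus `u =
    -- v`, and this single term of `∂w` cancels `z` at `τ`.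
    have hA : ∀ τ, (c τ).card = m → v (c τ) ∉ τ → (z - boundary 𝕜 γ w) τ = 0 := by
      intro τ hτm hvτ
      by_contra h
      obtain ⟨hτK, hτn⟩ := hz'K τ h
      obtain ⟨h1, h2, h3⟩ := hv τ hτK ⟨τ, hτK, hτn, rfl⟩
      refine h ?_
      rw [Finsupp.sub_apply, boundary_apply, Finset.sum_eq_single (v (c τ)), hw, h2, if_pos,
        Finset.erase_insert hvτ, ← mul_assoc, faceSign_mul_self, one_mul, sub_self]
      · exact ⟨Finset.mem_insert_self _ _, hτm, by rw [Finset.erase_insert hvτ], h1⟩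
      · intro u _ huv
        by_cases h : w (insert u τ) = 0
        · rw [h, mul_zero]
        obtain ⟨h4, h5, -, -⟩ := hw0 _ h
        have h6 : c τ = c (insert u τ) :=
          Finset.eq_of_subset_of_card_le (hc _ _ (Finset.subset_insert u τ)) (by omega)
        rw [← h6, Finset.mem_insert] at h4
        rcases h4 with h4 | h4
        · exact absurd h4.symm huv
        · exact absurd h4 hvτ
      · intro h
        exact absurd (Finset.mem_compl.2 hvτ) h
    have hB : ∀ τ, (z - boundary 𝕜 γ w) τ ≠ 0 → (c τ).card < m := by
      intro τ hτ
      refine lt_of_le_of_ne (hle τ hτ) fun hτm => ?_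
      obtain ⟨hτK, hτn⟩ := hz'K τ hτ
      have hvτ : v (c τ) ∈ τ := by
        by_contra h
        exact hτ (hA τ hτm h)
      obtain ⟨h1, h2, h3⟩ := hv τ hτK ⟨τ, hτK, hτn, rfl⟩
      -- Read the cycle condition at `τ ∖ v`. Any other face covering it either lies above level `m`
      -- or is in the class of `τ` and lacks `v`; the coefficient is zero in both cases, so the one
      -- at `τ` vanishes too.
      have hker : boundary 𝕜 γ (z - boundary 𝕜 γ w) (τ.erase (v (c τ))) = 0 := by
        rw [LinearMap.mem_ker.1 hz'.2, Finsupp.zero_apply]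
      rw [boundary_apply, Finset.sum_eq_single (v (c τ)), Finset.insert_erase hvτ] at hker
      · exact (mul_ne_zero (faceSign_ne_zero 𝕜 γ _ _) hτ) hker
      · intro u _ huv
        by_cases h : (z - boundary 𝕜 γ w) (insert u (τ.erase (v (c τ)))) = 0
        · rw [h, mul_zero]
        have h4 := hle _ h
        have h5 : c τ = c (insert u (τ.erase (v (c τ)))) := by
          refine Finset.eq_of_subset_of_card_le ?_ (by omega)
          conv_lhs => rw [← h3]
          exact hc _ _ (Finset.subset_insert _ _)
        refine absurd (hA _ (by rw [← h5, hτm]) ?_) h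
        rw [← h5]
        simp [huv.symm]
      · intro h
        exact absurd (Finset.mem_compl.2 (Finset.notMem_erase _ _)) h
    have := add_mem (ih _ hz' hB) (show boundary 𝕜 γ w ∈ boundarySpace 𝕜 γ n from ⟨w, hwC, rfl⟩)
    rwa [sub_add_cancel] at this

end BoundaryMap

/-! ### The Hopf trace formula -/

section HopfTrace

variable {V Γ G : Type*} [LinearOrder Γ] [Group G] {K : FaceComplex V} (γ : ProperColoring K Γ)
  (A : ComplexAction G K) (hγ : A.Preserves γ)

theorem chainSpace_character (n : ℕ) :
    ((permRep ℂ (finsetPerm A.toPerm)).subrepresentation (chainSpace ℂ K n)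
      (chainSpace_le_comap ℂ A n)).character = fChar A n :=
  character_supported _ _ _ _

/-- The character afforded by the cycles. -/
noncomputable def cycleChar (n : ℕ) : G → ℂ :=
  ((permRep ℂ (finsetPerm A.toPerm)).subrepresentation (cycleSpace ℂ γ n)
    (cycleSpace_le_comap ℂ γ A hγ n)).character

/-- The character afforded by the boundaries. -/
noncomputable def boundaryChar (n : ℕ) : G → ℂ :=
  ((permRep ℂ (finsetPerm A.toPerm)).subrepresentation (boundarySpace ℂ γ n)
    (boundarySpace_le_comap ℂ γ A hγ n)).character

theorem finiteDimensional_chainSpace [Finite V] (n : ℕ) :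
    FiniteDimensional ℂ (chainSpace ℂ K n) := by
  have : FiniteDimensional ℂ (Finset V →₀ ℂ) := inferInstance
  infer_instance

/-- The boundary map gives an equivariant exact sequence from cycles to chains to the boundaries one
degree lower. -/
theorem fChar_succ_eq_cycleChar_add [Finite V] (n : ℕ) :
    fChar A (n + 1) = cycleChar γ A hγ (n + 1) + boundaryChar γ A hγ n := by
  have := finiteDimensional_chainSpace (K := K) (n + 1)
  rw [← chainSpace_character]
  ext g
  let p : chainSpace ℂ K (n + 1) →ₗ[ℂ] boundarySpace ℂ γ n :=
    (boundary ℂ γ).restrict fun x hx => ⟨x, hx, rfl⟩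
  refine trace_eq_add_of_exact (Submodule.inclusion inf_le_left) p
    (Submodule.inclusion_injective _) ?_ ?_ _ _ _ (fun _ => rfl) ?_
  · rintro ⟨_, x, hx, rfl⟩
    exact ⟨⟨x, hx⟩, rfl⟩
  · intro x
    constructor
    · intro hx
      exact ⟨⟨x, x.2, congrArg Subtype.val hx⟩, rfl⟩
    · rintro ⟨y, rfl⟩
      exact Subtype.ext y.2.2
  · intro x
    exact Subtype.ext (boundary_permRep ℂ γ A hγ g x)

theorem fChar_zero_eq_cycleChar : fChar A 0 = cycleChar γ A hγ 0 := by
  rw [← chainSpace_character]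
  ext g
  refine (trace_eq_of_linearEquiv (LinearEquiv.ofEq (cycleSpace ℂ γ 0) (chainSpace ℂ K 0) ?_)
    _ _ fun _ => rfl).symm
  refine inf_eq_left.2 fun x hx => LinearMap.mem_ker.2 ?_
  refine chainSpace_induction ℂ (p := fun x => boundary ℂ γ x = 0) (by simp)
    (fun x y hx hy => by simp [hx, hy]) (fun σ hσ hn c => ?_) hx
  rw [boundary_single, Finset.card_eq_zero.1 hn, Finset.sum_empty]

/-- Below `N` cycles and boundaries coincide, so the exact sequences telescope to the character of
the top cycles. There are no faces with `N + 1` elements, so top homology is just the top cycles. -/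
theorem homologyRep_character [Finite V] {N : ℕ}
    (hlt : ∀ n < N, cycleSpace ℂ γ n ≤ boundarySpace ℂ γ n)
    (hgt : ∀ σ ∈ K, σ.card ≤ N) :
    (homologyRep ℂ γ A hγ N).character =
      ∑ n ∈ Finset.range (N + 1), (-1) ^ (N - n) * fChar A n := by
  have h1 : ∀ n ≤ N, cycleChar γ A hγ n =
      ∑ j ∈ Finset.range (n + 1), (-1) ^ (n - j) * fChar A j := by
    intro n
    induction n with
    | zero => simp [fChar_zero_eq_cycleChar γ A hγ]
    | succ n ih =>
      intro hn
      have h : cycleChar γ A hγ n = boundaryChar γ A hγ n := by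
        ext g
        exact trace_eq_of_linearEquiv (LinearEquiv.ofEq _ _
          ((hlt n hn).antisymm (boundarySpace_le_cycleSpace ℂ γ n))) _ _ fun _ => rfl
      rw [Finset.sum_range_succ, Nat.sub_self, pow_zero, one_mul,
        fChar_succ_eq_cycleChar_add γ A hγ, ← h, ih (by omega), add_left_comm,
        ← Finset.sum_add_distrib, Finset.sum_eq_zero, add_zero]
      intro j hj
      have : n + 1 - j = n - j + 1 := by
        have := Finset.mem_range.1 hj
        omega
      rw [this, pow_succ]
      ring
  rw [← h1 N le_rfl]
  ext g
  refine (trace_eq_of_linearEquiv (Submodule.quotEquivOfEqBot _ ?_).symm _ _ fun _ => rfl).symm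
  rw [boundarySpace, chainSpace_eq_bot ℂ fun σ hσ => (Nat.lt_succ_of_le (hgt σ hσ)).ne,
    Submodule.map_bot, Submodule.submoduleOf, Submodule.comap_bot, Submodule.ker_subtype]

end HopfTrace

/-! ### Homology of the rank-selected order complexes of `J(X)` -/

/-- A finite linearly ordered set has initial segments of all sizes. -/
theorem exists_initial_segment {X L : Type*} [Fintype X] [LinearOrder L] (k : X → L)
    {s : ℕ} (hs : s ≤ Fintype.card X) :
    ∃ v : Finset X, v.card = s ∧ ∀ x y, k x < k y → y ∈ v → x ∈ v := by
  classical
  induction s with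
  | zero => exact ⟨∅, rfl, by simp⟩
  | succ s ih =>
    obtain ⟨v, hv, h⟩ := ih (by omega)
    have hne : vᶜ.Nonempty := by
      rw [← Finset.card_pos, Finset.card_compl]
      omega
    obtain ⟨u, hu, hmin⟩ := vᶜ.exists_min_image k hne
    rw [Finset.mem_compl] at hu
    refine ⟨insert u v, by rw [Finset.card_insert_of_notMem hu, hv], fun x y hxy hy => ?_⟩
    rcases Finset.mem_insert.1 hy with rfl | hy
    · by_contra hx
      have hx' : x ∉ v := fun h' => hx (Finset.mem_insert_of_mem h')
      exact (hmin x (Finset.mem_compl.2 hx')).not_gt hxy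
    · exact Finset.mem_insert_of_mem (h x y hxy hy)

section RankSelection

variable {X Λ : Type*} [PartialOrder X] (ω : X → Λ)

open scoped Classical in
/-- The number of members of `σ` that do not contain `x`. -/
noncomputable def depth (σ : Finset (LowerSet X)) (x : X) : ℕ :=
  (σ.filter fun I => x ∉ I).card

/-- The points of `X` are ordered by their depth in `σ`, and by `ω` within each depth. -/
noncomputable def chainKey (σ : Finset (LowerSet X)) (x : X) : Lex (ℕ × Λ) :=
  toLex (depth σ x, ω x)

variable {ω} in
theorem chainKey_injective (hω : Function.Injective ω) (σ : Finset (LowerSet X)) :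
    Function.Injective (chainKey ω σ) := fun _ _ h =>
  hω (congrArg (fun p => (ofLex p).2) h)

variable [LinearOrder Λ]

open scoped Classical in
/-- The pairs that `chainKey` orders differently from `ω`. -/
noncomputable def inversions [Fintype X] (σ : Finset (LowerSet X)) : Finset (X × X) :=
  Finset.univ.filter fun p => ω p.1 < ω p.2 ∧ ∃ I ∈ σ, p.2 ∈ I ∧ p.1 ∉ I

theorem mem_inversions [Fintype X] {σ : Finset (LowerSet X)} {x y : X} :
    (x, y) ∈ inversions ω σ ↔ ω x < ω y ∧ ∃ I ∈ σ, y ∈ I ∧ x ∉ I := by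
  simp [inversions]

theorem inversions_mono [Fintype X] {τ σ : Finset (LowerSet X)} (h : τ ⊆ σ) :
    inversions ω τ ⊆ inversions ω σ := by
  rintro ⟨x, y⟩ hp
  rw [mem_inversions] at hp ⊢
  obtain ⟨h1, I, hI, h2⟩ := hp
  exact ⟨h1, I, h hI, h2⟩

/-- The members of a chain are nested, so the subfamilies omitting `x` and omitting `y` are
comparable, and their sizes decide the inclusion. -/
theorem depth_lt_iff {σ : Finset (LowerSet X)} (hσ : σ ∈ orderComplex (LowerSet X)) {x y : X} :
    depth σ y < depth σ x ↔ ∃ I ∈ σ, y ∈ I ∧ x ∉ I := by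
  classical
  constructor
  · intro h
    by_contra! h'
    refine h.not_ge (Finset.card_le_card fun I hI => ?_)
    rw [Finset.mem_filter] at hI ⊢
    exact ⟨hI.1, fun hy => hI.2 (h' I hI.1 hy)⟩
  · rintro ⟨I, hI, hy, hx⟩
    refine Finset.card_lt_card (Finset.ssubset_iff_of_subset (fun J hJ => ?_) |>.2 ⟨I, ?_, ?_⟩)
    · rw [Finset.mem_filter] at hJ ⊢
      refine ⟨hJ.1, fun hxJ => ?_⟩
      rcases hσ.total hI hJ.1 with h | h
      · exact hJ.2 (h hy)
      · exact hx (h hxJ)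
    · exact Finset.mem_filter.2 ⟨hI, hx⟩
    · exact fun h => (Finset.mem_filter.1 h).2 hy

theorem chainKey_lt {σ : Finset (LowerSet X)} {x y : X} :
    chainKey ω σ x < chainKey ω σ y ↔
      depth σ x < depth σ y ∨ depth σ x = depth σ y ∧ ω x < ω y := by
  simp [chainKey, Prod.Lex.toLex_lt_toLex]

variable {ω}

/-- The order defined by a chain is again a linear extension of `X`, so its initial segments are
order ideals. -/
theorem chainKey_mono (hω : Monotone ω) (σ : Finset (LowerSet X)) : Monotone (chainKey ω σ) := by
  classical
  intro x y h
  have h1 : depth σ x ≤ depth σ y := by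
    refine Finset.card_le_card fun I hI => ?_
    rw [Finset.mem_filter] at hI ⊢
    exact ⟨hI.1, fun hy => hI.2 (I.lower h hy)⟩
  rcases h1.lt_or_eq with h2 | h2
  · exact ((chainKey_lt ω).2 (Or.inl h2)).le
  · rcases (hω h).lt_or_eq with h3 | h3
    · exact ((chainKey_lt ω).2 (Or.inr ⟨h2, h3⟩)).le
    · rw [chainKey, chainKey, h2, h3]

/-- The inversion set determines the linear order, so chains with equal inversions define the same
linear extension. -/
theorem chainKey_lt_iff [Fintype X] (hω : Function.Injective ω) {σ : Finset (LowerSet X)}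
    (hσ : σ ∈ orderComplex (LowerSet X)) {x y : X} :
    chainKey ω σ x < chainKey ω σ y ↔
      ω x < ω y ∧ (x, y) ∉ inversions ω σ ∨ (y, x) ∈ inversions ω σ := by
  rw [chainKey_lt, mem_inversions, mem_inversions, ← depth_lt_iff hσ, ← depth_lt_iff hσ]
  rcases lt_trichotomy (ω x) (ω y) with h | h | h
  · simp only [h, h.not_gt, true_and, and_true, false_and, or_false]
    omega
  · simp [hω h]
  · simp only [h, h.not_gt, true_and, and_false, false_and, or_false, false_or]

theorem mem_of_chainKey_lt {σ : Finset (LowerSet X)} (hσ : σ ∈ orderComplex (LowerSet X))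
    {I : LowerSet X} (hI : I ∈ σ) {x y : X} (h : chainKey ω σ x < chainKey ω σ y) (hy : y ∈ I) :
    x ∈ I := by
  by_contra hx
  exact h.not_gt ((chainKey_lt ω).2 (Or.inl ((depth_lt_iff hσ).2 ⟨I, hI, hy, hx⟩)))

/-- If the chain `τ` has no member of rank `s`, then the initial segment of size `s` with respect to
`τ` can be added to and removed from all chains with the same inversions as `τ`. -/
theorem exists_toggle [Fintype X] (hω : Function.Injective ω) (hω' : Monotone ω)
    {τ : Finset (LowerSet X)} (hτ : τ ∈ orderComplex (LowerSet X)) {s : ℕ} (hs : 0 < s)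
    (hs' : s < Fintype.card X) (hsτ : ∀ I ∈ τ, (I : Set X).ncard ≠ s) :
    ∃ v : LowerSet X, (v : Set X).ncard = s ∧
      open scoped Classical in ∀ σ ∈ orderComplex (LowerSet X), inversions ω σ = inversions ω τ →
        insert v σ ∈ orderComplex (LowerSet X) ∧ inversions ω (insert v σ) = inversions ω σ ∧
          inversions ω (σ.erase v) = inversions ω σ := by
  classical
  obtain ⟨w, hw, hinit⟩ := exists_initial_segment (chainKey ω τ) hs'.le
  -- `u` is the last point of the segment `w` and `u'` the first point after it: rank `s` is a
  -- descent exactly when `ω u' < ω u`.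
  obtain ⟨u, hu, hmax⟩ := w.exists_max_image (chainKey ω τ) (Finset.card_pos.1 (by omega))
  obtain ⟨u', hu', hmin⟩ := wᶜ.exists_min_image (chainKey ω τ)
    (Finset.card_pos.1 (by rw [Finset.card_compl]; omega))
  rw [Finset.mem_compl] at hu'
  let v : LowerSet X := ⟨w, fun y x hxy hy => by
    rcases (chainKey_mono hω' τ hxy).lt_or_eq with h | h
    · exact hinit x y h hy
    · rwa [chainKey_injective hω τ h]⟩
  have hvw : ∀ x, x ∈ v ↔ x ∈ w := fun x => Iff.rfl
  have hvs : (v : Set X).ncard = s := by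
    change (w : Set X).ncard = s
    rw [Set.ncard_coe_finset, hw]
  have hvτ : v ∉ τ := fun h => hsτ v h hvs
  have hlt : ∀ {x y}, y ∈ w → x ∉ w → chainKey ω τ y < chainKey ω τ x := by
    intro x y hy hx
    rcases lt_trichotomy (chainKey ω τ y) (chainKey ω τ x) with h | h | h
    · exact h
    · exact absurd (chainKey_injective hω τ h ▸ hy) hx
    · exact absurd (hinit x y h hy) hx
  refine ⟨v, hvs, fun σ hσ hστ => ?_⟩
  have hkey : ∀ {x y}, chainKey ω σ x < chainKey ω σ y ↔ chainKey ω τ x < chainKey ω τ y := by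
    intro x y
    rw [chainKey_lt_iff hω hσ, chainKey_lt_iff hω hτ, hστ]
  have hmem : ∀ {I}, I ∈ σ → ∀ {x y}, chainKey ω τ x < chainKey ω τ y → y ∈ I → x ∈ I :=
    fun hI _ _ h hy => mem_of_chainKey_lt hσ hI (hkey.2 h) hy
  have hinv : ∀ {x y}, ω x < ω y → chainKey ω τ y < chainKey ω τ x → (x, y) ∈ inversions ω σ := by
    intro x y h h'
    rw [hστ]
    rcases (chainKey_lt_iff hω hτ).1 h' with h' | h'
    · exact absurd h'.1 h.not_gt
    · exact h'
  refine ⟨?_, ?_, ?_⟩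
  · change IsChain (· ≤ ·) ((insert v σ : Finset (LowerSet X)) : Set (LowerSet X))
    rw [Finset.coe_insert]
    refine IsChain.insert hσ fun I hI _ => ?_
    by_contra! h
    obtain ⟨h1, h2⟩ := h
    obtain ⟨y, hy, hyI⟩ := Set.not_subset.1 h1
    obtain ⟨x, hx, hxv⟩ := Set.not_subset.1 h2
    exact hyI (hmem hI (hlt hy hxv) hx)
  -- A pair separated by `v` against `ω` is already reversed by the linear order of `τ`, so it is
  -- not new.
  · refine Finset.Subset.antisymm (fun p hp => ?_) (inversions_mono ω (Finset.subset_insert v σ))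
    obtain ⟨x, y⟩ := p
    obtain ⟨hxy, I, hI, hyI, hxI⟩ := (mem_inversions ω).1 hp
    rcases Finset.mem_insert.1 hI with rfl | hI
    · exact hinv hxy (hlt hyI hxI)
    · exact (mem_inversions ω).2 ⟨hxy, I, hI, hyI, hxI⟩
  · refine Finset.Subset.antisymm (inversions_mono ω (Finset.erase_subset v σ)) fun p hp => ?_
    obtain ⟨x, y⟩ := p
    obtain ⟨hxy, I, hI, hyI, hxI⟩ := (mem_inversions ω).1 hp
    by_contra hcon
    -- If deleting `v` loses the inversion `(x, y)`, then `v` alone separates `y` from `x`. The next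
    -- two claims give `ω u' ≤ ω x < ω y ≤ ω u`, a descent at rank `s`.
    have hsep : ∀ J ∈ σ, J ≠ v → y ∈ J → x ∈ J := by
      intro J hJ hJv hyJ
      by_contra hxJ
      exact hcon ((mem_inversions ω).2 ⟨hxy, J, Finset.mem_erase.2 ⟨hJv, hJ⟩, hyJ, hxJ⟩)
    obtain rfl : I = v := by
      by_contra h
      exact hxI (hsep I hI h hyI)
    have h1 : ω y ≤ ω u := by
      by_contra! h
      have hyu : chainKey ω τ y < chainKey ω τ u :=
        lt_of_le_of_ne (hmax y hyI) fun h' => h.ne (congrArg ω (chainKey_injective hω τ h')).symm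
      obtain ⟨-, J, hJ, hyJ, huJ⟩ := (mem_inversions ω).1 (hinv h hyu)
      refine huJ (hmem hJ (hlt hu hxI) (hsep J hJ ?_ hyJ))
      rintro rfl
      exact huJ hu
    have h2 : ω u' ≤ ω x := by
      by_contra! h
      have hxu : chainKey ω τ u' < chainKey ω τ x :=
        lt_of_le_of_ne (hmin x (Finset.mem_compl.2 hxI))
          fun h' => h.ne (congrArg ω (chainKey_injective hω τ h')).symm
      obtain ⟨-, J, hJ, huJ, hxJ⟩ := (mem_inversions ω).1 (hinv h hxu)
      refine hxJ (hsep J hJ ?_ (hmem hJ (hlt hyI hu') huJ))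
      rintro rfl
      exact hu' huJ
    have h3 := hinv (h2.trans_lt (hxy.trans_le h1)) (hlt hu hu')
    rw [hστ] at h3
    obtain ⟨-, J, hJ, huJ, hu'J⟩ := (mem_inversions ω).1 h3
    -- A member of `τ` separating `u` from `u'` is an initial segment ending exactly at `u`, hence
    -- equals `v`, which has the rank missing from `τ`.
    refine hvτ ?_
    convert hJ
    ext z
    constructor
    · intro hz
      rcases (hmax z hz).lt_or_eq with h | h
      · exact mem_of_chainKey_lt hτ hJ h huJ
      · rwa [chainKey_injective hω τ h]
    · intro hz
      by_contra hzw
      rcases (hmin z (Finset.mem_compl.2 hzw)).lt_or_eq with h | h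
      · exact hu'J (mem_of_chainKey_lt hτ hJ h hz)
      · exact hu'J (chainKey_injective hω τ h ▸ hz)

end RankSelection

theorem card_le_of_mem_colorSelect {V Γ : Type*} {K : FaceComplex V} (γ : ProperColoring K Γ)
    (S : Finset Γ) {σ : Finset V} (hσ : σ ∈ colorSelect γ S) : σ.card ≤ S.card :=
  Finset.card_le_card_of_injOn γ.color hσ.2 (γ.injOn σ hσ.1)

/-- A chain with fewer than `|S|` members misses a rank in `S`; the initial segment of that rank is
the toggle vertex for its whole inversion class. -/
theorem rankSelected_cycleSpace_le_boundarySpace (𝕜 : Type*) [Field 𝕜] {X : Type*} [PartialOrder X]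
    [Finite X] {S : Finset ℕ} (hS : S ⊆ Finset.Icc 1 (Nat.card X - 1)) {n : ℕ} (hn : n < S.card) :
    cycleSpace 𝕜 ((rankColoring X).select S) n ≤ boundarySpace 𝕜 ((rankColoring X).select S) n := by
  classical
  cases nonempty_fintype X
  let ω : X → LinearExtension X := toLinearExtension
  have hω : Function.Injective ω := fun _ _ h => h
  have hω' : Monotone ω := toLinearExtension.monotone
  have key : ∀ D, ∃ v : LowerSet X, ∀ σ ∈ colorSelect (rankColoring X) S, inversions ω σ = D →
      (∃ τ ∈ colorSelect (rankColoring X) S, τ.card = n ∧ inversions ω τ = inversions ω σ) →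
      insert v σ ∈ colorSelect (rankColoring X) S ∧ inversions ω (insert v σ) = inversions ω σ ∧
        inversions ω (σ.erase v) = inversions ω σ := by
    intro D
    by_cases hD : ∃ τ ∈ colorSelect (rankColoring X) S, τ.card = n ∧ inversions ω τ = D
    · obtain ⟨τ, hτ, hτn, rfl⟩ := hD
      obtain ⟨s, hsS, hs⟩ : ∃ s ∈ S, s ∉ τ.image (rankColoring X).color := by
        by_contra! h
        have := (Finset.card_le_card (s := S) h).trans Finset.card_image_le
        omega
      have hs1 := Finset.mem_Icc.1 (hS hsS)
      rw [Nat.card_eq_fintype_card] at hs1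
      obtain ⟨v, hv, H⟩ := exists_toggle hω hω' hτ.1 (s := s) (by omega) (by omega)
        fun I hI h => hs (Finset.mem_image.2 ⟨I, hI, h⟩)
      refine ⟨v, fun σ hσ hστ _ => ?_⟩
      obtain ⟨h1, h2, h3⟩ := H σ hσ.1 hστ
      refine ⟨⟨h1, fun I hI => ?_⟩, h2, h3⟩
      rcases Finset.mem_insert.1 hI with rfl | hI
      · exact (congrArg (· ∈ S) hv).mpr hsS
      · exact hσ.2 I hI
    · refine ⟨⊥, fun σ hσ hσD hex => absurd ?_ hD⟩
      obtain ⟨τ, h1, h2, h3⟩ := hex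
      exact ⟨τ, h1, h2, h3.trans hσD⟩
  choose v hv using key
  refine cycleSpace_le_boundarySpace 𝕜 _ (inversions ω) (fun τ σ h => inversions_mono ω h) v
    fun σ hσ hex => ?_
  convert hv _ σ hσ rfl hex

/-! ### The monomial basis of the Stanley--Reisner ring -/

/-- The action on the exponent vectors of monomials induced by an action on the variables. -/
noncomputable def monomialPerm {G V : Type*} [Group G] (φ : G →* Equiv.Perm V) :
    G →* Equiv.Perm (V →₀ ℕ) where
  toFun g := (Finsupp.domCongr (φ g)).toEquiv
  map_one' := by
    ext u v
    rw [map_one]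
    rfl
  map_mul' x y := by
    ext u v
    rw [map_mul]
    rfl

theorem monomialPerm_apply {G V : Type*} [Group G] (φ : G →* Equiv.Perm V) (g : G) (u : V →₀ ℕ)
    (v : V) : monomialPerm φ g u v = u ((φ g).symm v) := rfl

theorem monomialPerm_eq_mapDomain {G V : Type*} [Group G] (φ : G →* Equiv.Perm V) (g : G)
    (u : V →₀ ℕ) : monomialPerm φ g u = u.mapDomain (φ g) :=
  Finsupp.equivMapDomain_eq_mapDomain _ _

theorem support_monomialPerm {G V : Type*} [Group G] (φ : G →* Equiv.Perm V) (g : G)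
    (u : V →₀ ℕ) : (monomialPerm φ g u).support = finsetPerm φ g u.support := by
  ext v
  simp [finsetPerm, monomialPerm_apply]

theorem degree_monomialPerm {G V : Type*} [Group G] (φ : G →* Equiv.Perm V) (g : G)
    (u : V →₀ ℕ) : (monomialPerm φ g u).degree = u.degree := by
  rw [Finsupp.degree_apply, Finsupp.degree_apply, support_monomialPerm]
  simp [finsetPerm, monomialPerm_apply]

/-- The exponent vectors of degree `i` whose support is a face. -/
def faceMonomials {V : Type*} (K : FaceComplex V) (i : ℕ) : Set (V →₀ ℕ) :=
  {u | u.support ∈ K ∧ u.degree = i}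

theorem monomialPerm_mem {G V : Type*} [Group G] {K : FaceComplex V} (A : ComplexAction G K)
    (i : ℕ) (g : G) (u : V →₀ ℕ) (hu : u ∈ faceMonomials K i) :
    monomialPerm A.toPerm g u ∈ faceMonomials K i := by
  refine ⟨?_, (degree_monomialPerm _ _ _).trans hu.2⟩
  rw [support_monomialPerm]
  exact A.map_mem g _ hu.1

/-- The ideal is monomial, so membership is tested term by term; a generator of a non-face divides a
monomial only if the support contains that non-face. -/
theorem mem_srIdeal_iff (𝕜 : Type*) [Field 𝕜] {V : Type*} (K : FaceComplex V)
    (p : MvPolynomial V 𝕜) : p ∈ srIdeal 𝕜 K ↔ ∀ u ∈ p.support, u.support ∉ K := by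
  classical
  have h : {m : MvPolynomial V 𝕜 | ∃ σ : Finset V, σ ∉ K ∧ m = ∏ v ∈ σ, MvPolynomial.X v} =
      (fun s => MvPolynomial.monomial s (1 : 𝕜)) ''
        {s | ∃ σ : Finset V, σ ∉ K ∧ s = ∑ v ∈ σ, Finsupp.single v 1} := by
    ext m
    constructor
    · rintro ⟨σ, hσ, rfl⟩
      exact ⟨_, ⟨σ, hσ, rfl⟩, MvPolynomial.monomial_sum_one σ _⟩
    · rintro ⟨_, ⟨σ, hσ, rfl⟩, rfl⟩
      exact ⟨σ, hσ, MvPolynomial.monomial_sum_one σ _⟩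
  have hle : ∀ (σ : Finset V) (u : V →₀ ℕ),
      ∑ v ∈ σ, Finsupp.single v 1 ≤ u ↔ σ ⊆ u.support := by
    intro σ u
    have : ∀ w, (∑ v ∈ σ, Finsupp.single v 1 : V →₀ ℕ) w = if w ∈ σ then 1 else 0 := by
      intro w
      simp [Finsupp.finsetSum_apply, Finsupp.single_apply]
    rw [Finsupp.le_def]
    refine forall_congr' fun w => ?_
    rw [this, Finsupp.mem_support_iff]
    split_ifs with hw <;> simp [hw, Nat.one_le_iff_ne_zero]
  rw [srIdeal, h, MvPolynomial.mem_ideal_span_monomial_image]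
  refine forall₂_congr fun u _ => ?_
  constructor
  · rintro ⟨_, ⟨σ, hσ, rfl⟩, hσu⟩ hu
    exact hσ (K.lower ((hle σ u).1 hσu) hu)
  · intro hu
    exact ⟨_, ⟨u.support, hu, rfl⟩, (hle _ u).2 subset_rfl⟩

section MonomialBasis

variable (𝕜 : Type*) [Field 𝕜] {V : Type*} (K : FaceComplex V) (i : ℕ)

/-- The polynomial with given coefficients at the monomials whose support is a face. -/
noncomputable def facePolynomial : (faceMonomials K i →₀ 𝕜) →ₗ[𝕜] MvPolynomial V 𝕜 :=
  Finsupp.linearCombination 𝕜 fun u => MvPolynomial.monomial u.1 1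

theorem facePolynomial_single (u : faceMonomials K i) (c : 𝕜) :
    facePolynomial 𝕜 K i (Finsupp.single u c) = MvPolynomial.monomial u.1 c := by
  simp [facePolynomial, MvPolynomial.smul_monomial]

theorem coeff_facePolynomial (x : faceMonomials K i →₀ 𝕜) (u : faceMonomials K i) :
    (facePolynomial 𝕜 K i x).coeff u.1 = x u := by
  classical
  induction x using Finsupp.induction_linear with
  | zero => simp
  | add x y hx hy => simp [hx, hy]
  | single w c =>
    rw [facePolynomial_single, MvPolynomial.coeff_monomial, Finsupp.single_apply]
    simp [Subtype.ext_iff]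

/-- The images of the monomials whose support is a face. -/
noncomputable def faceMonomialMap : (faceMonomials K i →₀ 𝕜) →ₗ[𝕜] SRRing 𝕜 K :=
  (Ideal.Quotient.mkₐ 𝕜 (srIdeal 𝕜 K)).toLinearMap ∘ₗ facePolynomial 𝕜 K i

theorem faceMonomialMap_injective : Function.Injective (faceMonomialMap 𝕜 K i) := by
  rw [← LinearMap.ker_eq_bot, LinearMap.ker_eq_bot']
  intro x hx
  have hx' : facePolynomial 𝕜 K i x ∈ srIdeal 𝕜 K := Ideal.Quotient.eq_zero_iff_mem.1 hx
  rw [mem_srIdeal_iff] at hx'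
  ext u
  by_contra h
  rw [Finsupp.zero_apply, ← coeff_facePolynomial 𝕜 K i] at h
  exact hx' u.1 (MvPolynomial.mem_support_iff.2 h) u.2.1

theorem range_faceMonomialMap :
    LinearMap.range (faceMonomialMap 𝕜 K i) = srComponent 𝕜 K i := by
  apply le_antisymm
  · rintro _ ⟨x, rfl⟩
    induction x using Finsupp.induction_linear with
    | zero => simp
    | add x y hx hy => rw [map_add]; exact add_mem hx hy
    | single u c =>
      refine ⟨_, ?_, rfl⟩
      rw [facePolynomial_single]
      exact MvPolynomial.isHomogeneous_monomial c u.2.2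
  · rintro _ ⟨p, hp, rfl⟩
    rw [p.as_sum, map_sum]
    refine Submodule.sum_mem _ fun u hu => ?_
    have hdeg : u.degree = i := by
      rw [Finsupp.degree_eq_weight_one]
      exact hp (MvPolynomial.mem_support_iff.1 hu)
    by_cases h : u.support ∈ K
    · refine ⟨Finsupp.single ⟨u, h, hdeg⟩ (p.coeff u), ?_⟩
      rw [faceMonomialMap, LinearMap.comp_apply, facePolynomial_single]
    · have hmem : MvPolynomial.monomial u (p.coeff u) ∈ srIdeal 𝕜 K := by
        rw [mem_srIdeal_iff]
        intro w hw
        rw [Finset.mem_singleton.1 (MvPolynomial.support_monomial_subset hw)]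
        exact h
      have h0 : (Ideal.Quotient.mkₐ 𝕜 (srIdeal 𝕜 K)).toLinearMap
          (MvPolynomial.monomial u (p.coeff u)) = 0 := Ideal.Quotient.eq_zero_iff_mem.2 hmem
      rw [h0]
      exact zero_mem _

end MonomialBasis

theorem coeff_eqHilb {G V : Type*} [Group G] {K : FaceComplex V} (A : ComplexAction G K) (i : ℕ) :
    PowerSeries.coeff i (eqHilb ℂ A) =
      permChar (monomialPerm A.toPerm) (faceMonomials K i) (monomialPerm_mem A i) := by
  rw [eqHilb, PowerSeries.coeff_mk]
  ext g
  refine (trace_eq_of_linearEquiv ((LinearEquiv.ofInjective _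
    (faceMonomialMap_injective ℂ K i)).trans (LinearEquiv.ofEq _ _
      (range_faceMonomialMap ℂ K i))) _ _ fun x => Subtype.ext ?_).symm
  change faceMonomialMap ℂ K i _ = srRep ℂ A g (faceMonomialMap ℂ K i x)
  induction x using Finsupp.induction_linear with
  | zero => simp
  | add x y hx hy => simp only [map_add, hx, hy]
  | single u c =>
    rw [permRep_single, faceMonomialMap, LinearMap.comp_apply, LinearMap.comp_apply,
      facePolynomial_single, facePolynomial_single]
    change Ideal.Quotient.mk _ (MvPolynomial.monomial (monomialPerm A.toPerm g u.1) c) =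
      Ideal.Quotient.mk _ (MvPolynomial.rename (A.toPerm g) (MvPolynomial.monomial u.1 c))
    rw [MvPolynomial.rename_monomial, monomialPerm_eq_mapDomain]

/-! ### Lattice points of dilated order polytopes and multichains of order ideals -/

section LatticePoints

variable {X : Type*} [PartialOrder X]

open scoped Classical in
/-- The number of members of the multiset `u` of order ideals that do not contain `x`. -/
noncomputable def height (u : LowerSet X →₀ ℕ) (x : X) : ℕ :=
  u.sum fun I n => if x ∈ I then 0 else n

theorem height_zero (x : X) : height (0 : LowerSet X →₀ ℕ) x = 0 := Finsupp.sum_zero_index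

theorem height_add (u v : LowerSet X →₀ ℕ) (x : X) :
    height (u + v) x = height u x + height v x :=
  Finsupp.sum_add_index' (by simp) fun I n n' => by split_ifs <;> rfl

open scoped Classical in
theorem height_single (I : LowerSet X) (n : ℕ) (x : X) :
    height (Finsupp.single I n) x = if x ∈ I then 0 else n :=
  Finsupp.sum_single_index (by simp)

theorem height_sum {ι : Type*} (s : Finset ι) (u : ι → LowerSet X →₀ ℕ) (x : X) :
    height (∑ j ∈ s, u j) x = ∑ j ∈ s, height (u j) x :=
  map_sum (⟨⟨fun u => height u x, height_zero x⟩, fun u v => height_add u v x⟩ :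
    (LowerSet X →₀ ℕ) →+ ℕ) u s

theorem height_le (u : LowerSet X →₀ ℕ) (x : X) : height u x ≤ u.degree := by
  refine Finset.sum_le_sum fun I _ => ?_
  dsimp only
  split_ifs <;> simp

theorem height_mono (u : LowerSet X →₀ ℕ) : Monotone (height u) := by
  intro x y h
  refine Finset.sum_le_sum fun I _ => ?_
  by_cases hx : x ∈ I
  · simp [hx]
  · have hy : y ∉ I := fun hy => hx (I.lower h hy)
    simp [hx, hy]

theorem height_eq_zero_iff (u : LowerSet X →₀ ℕ) (x : X) :
    height u x = 0 ↔ ∀ I ∈ u.support, x ∈ I := by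
  rw [height, Finsupp.sum, Finset.sum_eq_zero_iff]
  refine forall₂_congr fun I hI => ?_
  rw [Finsupp.mem_support_iff] at hI
  simp [hI]

/-- The least member of a multichain is recovered as the zero set of its height function; remove it
once and induct. -/
theorem height_injOn (m : ℕ) :
    Set.InjOn height (faceMonomials (orderComplex (LowerSet X)) m) := by
  classical
  induction m with
  | zero =>
    intro u hu u' hu' _
    rw [(Finsupp.degree_eq_zero_iff u).1 hu.2, (Finsupp.degree_eq_zero_iff u').1 hu'.2]
  | succ m ih =>
    have key : ∀ u ∈ faceMonomials (orderComplex (LowerSet X)) (m + 1), ∃ I : LowerSet X,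
        ∃ v ∈ faceMonomials (orderComplex (LowerSet X)) m, u = v + Finsupp.single I 1 ∧
          ∀ x, x ∈ I ↔ height u x = 0 := by
      intro u hu
      have hne : u.support.Nonempty := by
        rw [Finsupp.support_nonempty_iff]
        rintro rfl
        exact absurd hu.2 (by simp)
      obtain ⟨I, hI⟩ := u.support.exists_minimal hne
      have hmin : ∀ J ∈ u.support, I ≤ J := fun J hJ => by
        rcases hu.1.total hI.1 hJ with h | h
        · exact h
        · exact hI.2 hJ h
      have hle : Finsupp.single I 1 ≤ u := by
        rw [Finsupp.single_le_iff]
        exact Nat.one_le_iff_ne_zero.2 (Finsupp.mem_support_iff.1 hI.1)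
      have hadd : u = u - Finsupp.single I 1 + Finsupp.single I 1 := (tsub_add_cancel_of_le hle).symm
      refine ⟨I, u - Finsupp.single I 1, ⟨?_, ?_⟩, hadd, fun x => ?_⟩
      · exact LowerSet.lower _ (Finsupp.support_mono tsub_le_self) hu.1
      · have h := hu.2
        rw [hadd, map_add, Finsupp.degree_single] at h
        omega
      · rw [height_eq_zero_iff]
        exact ⟨fun hx J hJ => hmin J hJ hx, fun h => h I hI.1⟩
    intro u hu u' hu' h
    obtain ⟨I, v, hv, rfl, hI⟩ := key u hu
    obtain ⟨I', v', hv', rfl, hI'⟩ := key u' hu'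
    obtain rfl : I = I' := by
      ext x
      have h0 := hI x
      rw [congrFun h x] at h0
      exact h0.trans (hI' x).symm
    congr 1
    refine ih hv hv' (funext fun x => ?_)
    have := congrFun h x
    rw [height_add, height_add] at this
    exact Nat.add_right_cancel this

theorem exists_height_eq {m : ℕ} {h : X → ℕ} (hmono : Monotone h) (hle : ∀ x, h x ≤ m) :
    ∃ u ∈ faceMonomials (orderComplex (LowerSet X)) m, height u = h := by
  classical
  -- Sublevel sets for `j < m`: exactly `h x` of them omit `x`, because `h x ≤ m`.
  let I : ℕ → LowerSet X := fun j => ⟨{x | h x ≤ j}, fun y x hxy hy => (hmono hxy).trans hy⟩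
  have hImono : Monotone I := fun j k hjk x hx => le_trans hx hjk
  refine ⟨∑ j ∈ Finset.range m, Finsupp.single (I j) 1, ⟨?_, by simp⟩, funext fun x => ?_⟩
  · have hsub : (∑ j ∈ Finset.range m, Finsupp.single (I j) 1).support ⊆
        (Finset.range m).image I := by
      intro J hJ
      obtain ⟨j, hj, hJ⟩ := Finset.mem_biUnion.1 (Finsupp.support_finsetSum hJ)
      rw [Finset.mem_singleton.1 (Finsupp.support_single_subset hJ)]
      exact Finset.mem_image_of_mem I hj
    refine LowerSet.lower _ hsub ?_
    intro J hJ J' hJ' _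
    obtain ⟨j, -, rfl⟩ := Finset.mem_image.1 (Finset.mem_coe.1 hJ)
    obtain ⟨k, -, rfl⟩ := Finset.mem_image.1 (Finset.mem_coe.1 hJ')
    exact (le_total j k).imp (fun h => hImono h) fun h => hImono h
  · rw [height_sum]
    have hI : ∀ j, x ∈ I j ↔ h x ≤ j := fun j => Iff.rfl
    simp only [height_single, hI]
    have hite : ∀ j, (if h x ≤ j then 0 else 1) = if j < h x then 1 else 0 := fun j => by
      split_ifs <;> omega
    simp only [hite]
    rw [Finset.sum_boole]
    have : (Finset.range m).filter (fun j => j < h x) = Finset.range (h x) := by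
      ext j
      have := hle x
      simp only [Finset.mem_filter, Finset.mem_range]
      omega
    rw [this, Finset.card_range, Nat.cast_id]

theorem mem_smul_orderPolytope_iff {m : ℕ} (hm : m ≠ 0) (f : X → ℝ) :
    f ∈ ((m : ℝ) • orderPolytope X) ∩ (intLattice X : Set (X → ℝ)) ↔
      ∃ h : X → ℕ, Monotone h ∧ (∀ x, h x ≤ m) ∧ f = fun x => (h x : ℝ) := by
  have hm' : (0 : ℝ) < m := Nat.cast_pos.2 (Nat.pos_of_ne_zero hm)
  constructor
  · rintro ⟨⟨p, hp, rfl⟩, hf⟩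
    choose k hk using hf
    have hk' : ∀ x, (m : ℝ) * p x = k x := hk
    -- The bounds `0 ≤ p x ≤ 1` come from the reflexive pair `x ≤ x`.
    have hk0 : ∀ x, 0 ≤ k x := fun x => by
      have : (0 : ℝ) ≤ k x := hk' x ▸ mul_nonneg hm'.le (hp x x le_rfl).1
      exact_mod_cast this
    have hcast : ∀ x, ((k x).toNat : ℝ) = m * p x := fun x => by
      rw [hk' x]
      exact_mod_cast Int.toNat_of_nonneg (hk0 x)
    refine ⟨fun x => (k x).toNat, fun x y hxy => ?_, fun x => ?_, funext fun x => (hcast x).symm⟩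
    · have : ((k x).toNat : ℝ) ≤ (k y).toNat := by
        rw [hcast, hcast]
        exact mul_le_mul_of_nonneg_left (hp x y hxy).2.1 hm'.le
      exact_mod_cast this
    · have : ((k x).toNat : ℝ) ≤ m := by
        rw [hcast]
        exact mul_le_of_le_one_right hm'.le (hp x x le_rfl).2.2
      exact_mod_cast this
  · rintro ⟨h, hmono, hle, rfl⟩
    refine ⟨⟨fun x => (h x : ℝ) / m, fun x y hxy => ⟨by positivity, ?_, ?_⟩, ?_⟩,
      fun x => ⟨h x, by simp⟩⟩
    · have : (h x : ℝ) ≤ h y := by exact_mod_cast hmono hxy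
      exact div_le_div_of_nonneg_right this hm'.le
    · rw [div_le_one hm']
      exact_mod_cast hle y
    · ext x
      simp only [Pi.smul_apply, smul_eq_mul]
      field_simp

theorem height_bijOn {m : ℕ} (hm : m ≠ 0) :
    Set.BijOn (fun (u : LowerSet X →₀ ℕ) (x : X) => (height u x : ℝ))
      (faceMonomials (orderComplex (LowerSet X)) m)
      (((m : ℝ) • orderPolytope X) ∩ (intLattice X : Set (X → ℝ))) := by
  refine ⟨fun u hu => ?_, fun u hu u' hu' h => ?_, fun f hf => ?_⟩
  · exact (mem_smul_orderPolytope_iff hm _).2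
      ⟨height u, height_mono u, fun x => hu.2 ▸ height_le u x, rfl⟩
  · exact height_injOn m hu hu' (funext fun x => Nat.cast_injective (congrFun h x))
  · obtain ⟨h, hmono, hle, rfl⟩ := (mem_smul_orderPolytope_iff hm f).1 hf
    obtain ⟨u, hu, rfl⟩ := exists_height_eq hmono hle
    exact ⟨u, hu, rfl⟩

variable {G : Type*} [Group G] (a : G →* (X ≃o X))

theorem height_monomialPerm (g : G) (u : LowerSet X →₀ ℕ) (x : X) :
    height (monomialPerm (idealAction a).toPerm g u) x = height u (a g⁻¹ x) := by
  classical
  rw [monomialPerm_eq_mapDomain, height, Finsupp.sum_mapDomain_index (by simp)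
    (fun I n n' => by split_ifs <;> rfl)]
  refine Finset.sum_congr rfl fun I _ => ?_
  have h : x ∈ (idealAction a).toPerm g I ↔ a g⁻¹ x ∈ I := by
    change x ∈ a g '' (I : Set X) ↔ _
    rw [map_inv]
    constructor
    · rintro ⟨y, hy, rfl⟩
      have h : (a g)⁻¹ (a g y) = y := (a g).symm_apply_apply y
      rwa [h]
    · intro hx
      exact ⟨_, hx, (a g).apply_symm_apply x⟩
  simp only [h]

theorem coordRep_image_orderPolytope (g : G) :
    coordRep a g '' orderPolytope X = orderPolytope X := by
  have h : ∀ g, ∀ f ∈ orderPolytope X, coordRep a g f ∈ orderPolytope X :=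
    fun g f hf x y hxy => hf _ _ ((a g⁻¹).monotone hxy)
  refine Set.Subset.antisymm ?_ fun f hf => ⟨coordRep a g⁻¹ f, h g⁻¹ f hf, ?_⟩
  · rintro _ ⟨f, hf, rfl⟩
    exact h g f hf
  · rw [← LinearEquiv.mul_apply, ← map_mul, mul_inv_cancel, map_one, LinearEquiv.coe_one, id]

theorem eqEhr_eq_eqHilb (hP : ∀ g, coordRep a g '' orderPolytope X = orderPolytope X) :
    eqEhr (coordRep a) (intLattice X) (coordRep_intLattice a) (orderPolytope X) hP =
      eqHilb ℂ (idealAction a) := by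
  ext m : 1
  rw [coeff_eqHilb, eqEhr, PowerSeries.coeff_mk]
  split_ifs with hm
  -- The constant term of the Ehrhart series is `1` by convention; on the other side the only
  -- monomial of degree zero is `1`.
  · subst hm
    have h0 : faceMonomials (orderComplex (LowerSet X)) 0 = {0} := by
      ext u
      rw [Set.mem_singleton_iff, ← Finsupp.degree_eq_zero_iff]
      refine ⟨fun h => h.2, fun h => ⟨?_, h⟩⟩
      rw [(Finsupp.degree_eq_zero_iff u).1 h, Finsupp.support_zero]
      intro I hI
      simp at hI
    ext g
    rw [permChar_apply _ _ _ (by rw [h0]; exact Set.finite_singleton 0)]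
    have : {u | u ∈ faceMonomials (orderComplex (LowerSet X)) 0 ∧
        monomialPerm (idealAction a).toPerm g u = u} = {0} := by
      rw [h0]
      ext u
      constructor
      · exact fun h => h.1
      · rintro rfl
        exact ⟨rfl, by rw [monomialPerm_eq_mapDomain, Finsupp.mapDomain_zero]⟩
    rw [this, Set.ncard_singleton, Pi.one_apply, Nat.cast_one]
  · exact (permChar_congr _ _ _ _ _ _ _ (height_bijOn hm) fun g u _ =>
      funext fun x => congrArg Nat.cast (height_monomialPerm a g u x)).symm

end LatticePoints

/-! ### Sums over the faces of a flag -/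

section FlagSums

/-- Interchange of summation over pairs `T ⊆ S ⊆ C`, with `S = T ∪ W`. -/
theorem sum_powerset_sum_powerset {Γ M : Type*} [DecidableEq Γ] [AddCommMonoid M] (C : Finset Γ)
    (F : Finset Γ → Finset Γ → M) :
    ∑ S ∈ C.powerset, ∑ T ∈ S.powerset, F S T =
      ∑ T ∈ C.powerset, ∑ W ∈ (C \ T).powerset, F (T ∪ W) T := by
  rw [Finset.sum_sigma', Finset.sum_sigma']
  refine Finset.sum_bij' (fun p _ => ⟨p.2, p.1 \ p.2⟩) (fun p _ => ⟨p.1 ∪ p.2, p.1⟩) ?_ ?_ ?_ ?_ ?_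
  · rintro ⟨S, T⟩ h
    simp only [Finset.mem_sigma, Finset.mem_powerset] at h ⊢
    exact ⟨h.2.trans h.1, Finset.sdiff_subset_sdiff h.1 subset_rfl⟩
  · rintro ⟨T, W⟩ h
    simp only [Finset.mem_sigma, Finset.mem_powerset] at h ⊢
    exact ⟨Finset.union_subset h.1 (h.2.trans Finset.sdiff_subset), Finset.subset_union_left⟩
  · rintro ⟨S, T⟩ h
    simp only [Finset.mem_sigma, Finset.mem_powerset] at h
    simp [Finset.union_sdiff_of_subset h.2]
  · rintro ⟨T, W⟩ h
    simp only [Finset.mem_sigma, Finset.mem_powerset] at h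
    have : Disjoint W T := (Finset.subset_sdiff.1 h.2).2
    simp [Finset.union_sdiff_left, this.sdiff_eq_left]
  · rintro ⟨S, T⟩ h
    simp only [Finset.mem_sigma, Finset.mem_powerset] at h
    simp [Finset.union_sdiff_of_subset h.2]

/-- The flag `h`-transform of a function on finite sets. -/
def flagTransform {Γ R : Type*} [Ring R] (f : Finset Γ → R) (S : Finset Γ) : R :=
  ∑ T ∈ S.powerset, (-1) ^ (S.card - T.card) * f T

theorem card_union_of_mem_powerset_sdiff {Γ : Type*} [DecidableEq Γ] {C T W : Finset Γ}
    (hW : W ∈ (C \ T).powerset) : (T ∪ W).card = T.card + W.card :=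
  Finset.card_union_of_disjoint (Finset.subset_sdiff.1 (Finset.mem_powerset.1 hW)).2.symm

/-- For fixed `T`, summing over `S ⊇ T` is the binomial expansion of `(b - a)^|C ∖ T|`. It is
applied with `a = t/(1-t)` and `b = 1/(1-t)`, where `b - a = 1`. -/
theorem sum_flagTransform_mul_pow {Γ R : Type*} [CommRing R] (f : Finset Γ → R)
    (C : Finset Γ) (a b : R) :
    ∑ S ∈ C.powerset, flagTransform f S * (a ^ S.card * b ^ (C.card - S.card)) =
      ∑ T ∈ C.powerset, f T * (a ^ T.card * (b - a) ^ (C.card - T.card)) := by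
  classical
  simp only [flagTransform, Finset.sum_mul]
  rw [sum_powerset_sum_powerset]
  refine Finset.sum_congr rfl fun T hT => ?_
  have hTC := Finset.mem_powerset.1 hT
  have hcard : (C \ T).card = C.card - T.card := Finset.card_sdiff_of_subset hTC
  rw [← hcard, sub_eq_neg_add, ← Finset.sum_pow_mul_eq_add_pow, Finset.mul_sum, Finset.mul_sum]
  refine Finset.sum_congr rfl fun W hW => ?_
  rw [card_union_of_mem_powerset_sdiff hW, Nat.add_sub_cancel_left, hcard, Nat.sub_sub, neg_pow a,
    pow_add]
  ring

/-- The binomial coefficient counts the `k`-subsets of `C` containing a given `i`-subset. -/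
theorem sum_powersetCard_flagTransform {Γ R : Type*} [CommRing R] (f : Finset Γ → R)
    (C : Finset Γ) (k : ℕ) :
    ∑ S ∈ C.powersetCard k, flagTransform f S =
      ∑ i ∈ Finset.range (k + 1), (-1) ^ (k - i) * ((C.card - i).choose (k - i) : R) *
        ∑ T ∈ C.powersetCard i, f T := by
  classical
  have h1 : ∑ S ∈ C.powersetCard k, flagTransform f S =
      ∑ T ∈ C.powerset, if T.card < k + 1 then
        (-1) ^ (k - T.card) * ((C.card - T.card).choose (k - T.card) : R) * f T else 0 := by
    rw [Finset.powersetCard_eq_filter, Finset.sum_filter]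
    have : ∀ S : Finset Γ, (if S.card = k then flagTransform f S else 0) =
        ∑ T ∈ S.powerset, if S.card = k then (-1) ^ (S.card - T.card) * f T else 0 := fun S => by
      split_ifs <;> simp [flagTransform]
    simp only [this]
    rw [sum_powerset_sum_powerset]
    refine Finset.sum_congr rfl fun T hT => ?_
    have hTC := Finset.mem_powerset.1 hT
    rw [← Finset.sum_filter]
    split_ifs with hk
    · rw [← Finset.card_sdiff_of_subset hTC, ← Finset.card_powersetCard,
        Finset.powersetCard_eq_filter, mul_right_comm, mul_comm, ← nsmul_eq_mul]
      have hset : (C \ T).powerset.filter (fun W => (T ∪ W).card = k) =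
          (C \ T).powerset.filter fun W => W.card = k - T.card :=
        Finset.filter_congr fun W hW => by
          rw [card_union_of_mem_powerset_sdiff hW]
          omega
      rw [hset]
      refine Finset.sum_eq_card_nsmul fun W hW => ?_
      obtain ⟨hW, hWk⟩ := Finset.mem_filter.1 hW
      rw [card_union_of_mem_powerset_sdiff hW, hWk, Nat.add_sub_cancel_left]
    · rw [Finset.filter_false_of_mem, Finset.sum_empty]
      intro W hW
      rw [card_union_of_mem_powerset_sdiff hW]
      omega
  rw [h1, ← Finset.sum_filter, ← Finset.sum_fiberwise_of_maps_to (t := Finset.range (k + 1))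
    (g := Finset.card) fun T hT => Finset.mem_range.2 (Finset.mem_filter.1 hT).2]
  refine Finset.sum_congr rfl fun i hi => ?_
  rw [Finset.filter_filter, Finset.mul_sum, Finset.powersetCard_eq_filter]
  refine Finset.sum_congr (Finset.filter_congr fun T _ => ?_) fun T hT => ?_
  · have := Finset.mem_range.1 hi
    constructor
    · exact fun h => h.2
    · intro h
      exact ⟨by omega, h⟩
  · rw [(Finset.mem_filter.1 hT).2]

end FlagSums

/-! ### Invariant faces -/

section InvariantFaces

variable {V Γ G : Type*} [Group G] {K : FaceComplex V} (A : ComplexAction G K)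
  (γ : ProperColoring K Γ) (hγ : A.Preserves γ)

theorem flagHChar_apply (S : Finset Γ) (g : G) :
    flagHChar A γ hγ S g = flagTransform (fun T => flagFChar A γ hγ T g) S := by
  simp [flagHChar, flagTransform, Finset.sum_apply]

open scoped Classical in
/-- The faces of `K` that are mapped to themselves by `g`. -/
noncomputable def invariantFaces [Fintype V] (g : G) : Finset (Finset V) :=
  Finset.univ.filter fun σ => σ ∈ K ∧ finsetPerm A.toPerm g σ = σ

theorem mem_invariantFaces [Fintype V] {g : G} {σ : Finset V} :
    σ ∈ invariantFaces A g ↔ σ ∈ K ∧ finsetPerm A.toPerm g σ = σ := by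
  simp [invariantFaces]

theorem card_image_color [DecidableEq Γ] {σ : Finset V} (hσ : σ ∈ K) :
    (σ.image γ.color).card = σ.card :=
  Finset.card_image_of_injOn (γ.injOn σ hσ)

theorem flagFChar_apply [Fintype V] [DecidableEq Γ] (T : Finset Γ) (g : G) :
    flagFChar A γ hγ T g =
      ((invariantFaces A g).filter fun σ => σ.image γ.color = T).card := by
  rw [flagFChar, permChar_apply _ _ _ (Set.toFinite _), ← Set.ncard_coe_finset]
  congr 2
  ext σ
  simp only [Finset.coe_filter, mem_invariantFaces, ← Finset.coe_image, Finset.coe_inj]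
  change (_ ∧ _) ∧ _ ↔ (_ ∧ _) ∧ _
  tauto

theorem fChar_apply [Fintype V] (n : ℕ) (g : G) :
    fChar A n g = ((invariantFaces A g).filter fun σ => σ.card = n).card := by
  rw [fChar, permChar_apply _ _ _ (Set.toFinite _), ← Set.ncard_coe_finset]
  congr 2
  ext σ
  simp only [Finset.coe_filter, mem_invariantFaces]
  change (_ ∧ _) ∧ _ ↔ (_ ∧ _) ∧ _
  tauto

theorem sum_flagFChar_mul [Fintype V] [DecidableEq Γ] {R : Type*} [CommRing R] [Algebra ℂ R]
    (𝒯 : Finset (Finset Γ)) (w : Finset Γ → R) (g : G) :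
    ∑ T ∈ 𝒯, algebraMap ℂ R (flagFChar A γ hγ T g) * w T =
      ∑ σ ∈ (invariantFaces A g).filter fun σ => σ.image γ.color ∈ 𝒯, w (σ.image γ.color) := by
  rw [← Finset.sum_fiberwise_of_maps_to (t := 𝒯) (g := fun σ : Finset V => σ.image γ.color)
    fun σ hσ => (Finset.mem_filter.1 hσ).2]
  refine Finset.sum_congr rfl fun T hT => ?_
  rw [Finset.filter_filter, flagFChar_apply, map_natCast, ← nsmul_eq_mul]
  have : (invariantFaces A g).filter (fun σ => σ.image γ.color ∈ 𝒯 ∧ σ.image γ.color = T) =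
      (invariantFaces A g).filter fun σ => σ.image γ.color = T :=
    Finset.filter_congr fun σ _ => ⟨fun h => h.2, fun h => ⟨h ▸ hT, h⟩⟩
  rw [this]
  refine (Finset.sum_eq_card_nsmul fun σ hσ => ?_).symm
  rw [(Finset.mem_filter.1 hσ).2]

theorem fChar_eq_sum_flagFChar [Finite V] {C : Finset Γ}
    (hC : ∀ σ ∈ K, ∀ v ∈ σ, γ.color v ∈ C) (n : ℕ) :
    fChar A n = ∑ T ∈ C.powersetCard n, flagFChar A γ hγ T := by
  classical
  cases nonempty_fintype V
  ext g
  have h := sum_flagFChar_mul A γ hγ (C.powersetCard n) (fun _ => (1 : ℂ)) g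
  simp only [Algebra.algebraMap_self, RingHom.id_apply, mul_one, Finset.sum_const,
    nsmul_eq_mul] at h
  rw [Finset.sum_apply, h, fChar_apply]
  congr 2
  refine Finset.filter_congr fun σ hσ => ?_
  have hK := ((mem_invariantFaces A).1 hσ).1
  rw [Finset.mem_powersetCard, card_image_color γ hK]
  exact ⟨fun h => ⟨Finset.image_subset_iff.2 fun v hv => hC σ hK v hv, h⟩, fun h => h.2⟩

theorem flagFChar_select [Finite V] {S T : Finset Γ} (hT : T ⊆ S) :
    flagFChar (A.select γ hγ S) (γ.select S) hγ T = flagFChar A γ hγ T := by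
  refine permChar_congr _ _ _ _ _ _ id ⟨fun σ h => ⟨h.1.1, h.2⟩, Set.injOn_id _, fun σ h =>
    ⟨σ, ⟨⟨h.1, fun v hv => hT ?_⟩, h.2⟩, rfl⟩⟩ fun _ _ _ => rfl
  have : γ.color v ∈ (T : Set Γ) := h.2 ▸ Set.mem_image_of_mem _ hv
  exact this

theorem flagHChar_eq_sum_fChar_select [Finite V] (S : Finset Γ) :
    flagHChar A γ hγ S =
      ∑ n ∈ Finset.range (S.card + 1), (-1) ^ (S.card - n) * fChar (A.select γ hγ S) n := by
  rw [flagHChar, Finset.sum_powerset]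
  refine Finset.sum_congr rfl fun n _ => ?_
  rw [fChar_eq_sum_flagFChar (A.select γ hγ S) (γ.select S) hγ (C := S) (fun σ hσ => hσ.2),
    Finset.mul_sum]
  refine Finset.sum_congr rfl fun T hT => ?_
  obtain ⟨hTS, hTn⟩ := Finset.mem_powersetCard.1 hT
  rw [flagFChar_select A γ hγ hTS, hTn]

/-- The flag `h`-entry vanishes if `S` contains the color of a cone point. -/
theorem flagHChar_eq_zero_of_cone {v : V} (hv : ∀ w, γ.color w = γ.color v → w = v)
    (hcone : open scoped Classical in ∀ σ ∈ K, insert v σ ∈ K) {S : Finset Γ}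
    (hS : γ.color v ∈ S) : flagHChar A γ hγ S = 0 := by
  classical
  have hgv : ∀ g, A.toPerm g v = v := fun g => hv _ (hγ g v)
  -- The fixed vertex `v` is the only one of its color, so adding it is an equivariant bijection of
  -- faces. The terms for `T` and `T ∪ {color v}` therefore cancel in the flag `h`-entry.
  have hf : ∀ T : Finset Γ, γ.color v ∉ T →
      flagFChar A γ hγ (insert (γ.color v) T) = flagFChar A γ hγ T := by
    intro T hT
    have hvσ : ∀ σ : Finset V, γ.color '' (σ : Set V) = T → v ∉ σ := fun σ h hvσ =>
      hT (Finset.mem_coe.1 (h ▸ Set.mem_image_of_mem _ hvσ))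
    refine (permChar_congr _ _ _ _ _ _ (fun σ => insert v σ) ⟨?_, ?_, ?_⟩ ?_).symm
    · rintro σ ⟨hσ, h⟩
      refine ⟨hcone σ hσ, ?_⟩
      rw [Finset.coe_insert, Set.image_insert_eq, h, Finset.coe_insert]
    · rintro σ ⟨-, h⟩ σ' ⟨-, h'⟩ heq
      rw [← Finset.erase_insert (hvσ σ h), ← Finset.erase_insert (hvσ σ' h')]
      exact congrArg (fun ρ => Finset.erase ρ v) heq
    · rintro σ ⟨hσ, h⟩
      have hmem : v ∈ σ := by
        have : γ.color v ∈ γ.color '' (σ : Set V) := by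
          rw [h]
          exact Finset.mem_coe.2 (Finset.mem_insert_self _ _)
        obtain ⟨w, hw, hwv⟩ := this
        exact hv w hwv ▸ hw
      refine ⟨σ.erase v, ⟨K.lower (Finset.erase_subset v σ) hσ, ?_⟩, Finset.insert_erase hmem⟩
      ext c
      constructor
      · rintro ⟨w, hw, rfl⟩
        obtain ⟨hwv, hw⟩ := Finset.mem_erase.1 (Finset.mem_coe.1 hw)
        have : γ.color w ∈ γ.color '' (σ : Set V) := Set.mem_image_of_mem _ hw
        rw [h, Finset.mem_coe, Finset.mem_insert] at this
        exact this.resolve_left fun h' => hwv (hv w h')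
      · intro hc
        have : c ∈ γ.color '' (σ : Set V) := by
          rw [h]
          exact Finset.mem_coe.2 (Finset.mem_insert_of_mem hc)
        obtain ⟨w, hw, rfl⟩ := this
        refine ⟨w, Finset.mem_coe.2 (Finset.mem_erase.2 ⟨?_, hw⟩), rfl⟩
        rintro rfl
        exact hT hc
    · intro g σ _
      change insert v (σ.map _) = (insert v σ).map _
      rw [Finset.map_insert]
      congr 1
      exact (hgv g).symm
  rw [flagHChar, ← Finset.insert_erase hS, Finset.sum_powerset_insert (Finset.notMem_erase _ _),
    ← Finset.sum_add_distrib, Finset.sum_eq_zero]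
  intro T hT
  have hT' := Finset.mem_powerset.1 hT
  have hvT : γ.color v ∉ T := fun h => Finset.notMem_erase _ _ (hT' h)
  have hcard := Finset.card_le_card hT'
  rw [hf T hvT, Finset.card_insert_of_notMem (Finset.notMem_erase _ _),
    Finset.card_insert_of_notMem hvT, Nat.add_sub_add_right, Nat.sub_add_comm hcard, pow_succ]
  ring

/-! ### The Hilbert series in terms of the flag `h`-vector -/

/-- Each factor `t/(1-t)` chooses a positive exponent for one vertex, so the power enumerates the
monomials with support exactly `σ`. -/
theorem coeff_X_mul_mk_one_pow {ι : Type*} (σ : Finset ι) (m : ℕ) :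
    open scoped Classical in
    PowerSeries.coeff m ((PowerSeries.X * PowerSeries.mk 1 : PowerSeries ℂ) ^ σ.card) =
      ((σ.finsuppAntidiag m).filter fun u => u.support = σ).card := by
  classical
  rw [← Finset.prod_const, PowerSeries.coeff_prod, Finset.card_eq_sum_ones, Nat.cast_sum,
    Finset.sum_filter]
  refine Finset.sum_congr rfl fun u hu => ?_
  have hsub := (Finset.mem_finsuppAntidiag.1 hu).2
  have hcoeff : ∀ n, PowerSeries.coeff n (PowerSeries.X * PowerSeries.mk 1 : PowerSeries ℂ) =
      if n ≠ 0 then 1 else 0 := by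
    intro n
    cases n with
    | zero => simp
    | succ n => rw [PowerSeries.coeff_succ_X_mul]; simp
  simp only [hcoeff]
  rw [Finset.prod_ite_zero, Finset.prod_const_one, Nat.cast_one]
  refine if_congr ⟨fun h => hsub.antisymm fun i hi => Finsupp.mem_support_iff.2 (h i hi), ?_⟩
    rfl rfl
  rintro rfl i hi
  exact Finsupp.mem_support_iff.1 hi

/-- Preserved colors that are distinct on a face leave no room to permute its vertices: an invariant
face is fixed pointwise, and so are the exponents on it. -/
theorem monomialPerm_eq_self_iff (γ : ProperColoring K Γ) (hγ : A.Preserves γ)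
    {u : V →₀ ℕ} (hu : u.support ∈ K) (g : G) :
    monomialPerm A.toPerm g u = u ↔ finsetPerm A.toPerm g u.support = u.support := by
  constructor
  · intro h
    rw [← support_monomialPerm, h]
  · intro h
    have hfix : ∀ v ∈ u.support, A.toPerm g v = v := by
      intro v hv
      refine γ.injOn _ hu ?_ hv (hγ g v)
      rw [← h]
      exact Finset.mem_map_of_mem _ hv
    ext v
    rw [monomialPerm_apply]
    set w := (A.toPerm g).symm v with hw
    have hwv : A.toPerm g w = v := Equiv.apply_symm_apply _ _
    by_cases hws : w ∈ u.support
    · rw [← hwv, hfix w hws]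
    · have hvs : v ∉ u.support := by
        intro hv
        refine hws ?_
        rw [hw, (Equiv.symm_apply_eq _).2 (hfix v hv).symm]
        exact hv
      rw [Finsupp.notMem_support_iff.1 hws, Finsupp.notMem_support_iff.1 hvs]

theorem map_eqHilb [Fintype V] (γ : ProperColoring K Γ) (hγ : A.Preserves γ) (g : G) :
    PowerSeries.map (Pi.evalRingHom (fun _ : G => ℂ) g) (eqHilb ℂ A) =
      ∑ σ ∈ invariantFaces A g, (PowerSeries.X * PowerSeries.mk 1) ^ σ.card := by
  classical
  ext m
  have hset : {u | u ∈ faceMonomials K m ∧ monomialPerm A.toPerm g u = u} =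
      (((Finset.univ : Finset V).finsuppAntidiag m).filter fun u =>
        u.support ∈ invariantFaces A g : Set (V →₀ ℕ)) := by
    ext u
    simp only [Finset.coe_filter, Finset.mem_finsuppAntidiag, mem_invariantFaces,
      Finset.subset_univ, and_true, ← Finsupp.degree_eq_sum]
    constructor
    · rintro ⟨⟨h1, h2⟩, h3⟩
      exact ⟨h2, h1, (monomialPerm_eq_self_iff A γ hγ h1 g).1 h3⟩
    · rintro ⟨h2, h1, h3⟩
      exact ⟨⟨h1, h2⟩, (monomialPerm_eq_self_iff A γ hγ h1 g).2 h3⟩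
  have hfin : (faceMonomials K m).Finite := by
    refine ((Finset.univ : Finset V).finsuppAntidiag m).finite_toSet.subset fun u hu => ?_
    rw [Finset.mem_coe, Finset.mem_finsuppAntidiag, ← Finsupp.degree_eq_sum]
    exact ⟨hu.2, Finset.subset_univ _⟩
  have hmaps : ∀ u ∈ ((Finset.univ : Finset V).finsuppAntidiag m).filter fun u =>
      u.support ∈ invariantFaces A g, u.support ∈ invariantFaces A g :=
    fun u hu => (Finset.mem_filter.1 hu).2
  rw [PowerSeries.coeff_map, coeff_eqHilb, Pi.evalRingHom_apply, permChar_apply _ _ _ hfin, hset,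
    Set.ncard_coe_finset, Finset.card_eq_sum_card_fiberwise hmaps, Nat.cast_sum, map_sum]
  refine Finset.sum_congr rfl fun σ hσ => ?_
  rw [coeff_X_mul_mk_one_pow]
  congr 2
  ext u
  simp only [Finset.mem_filter, Finset.mem_finsuppAntidiag, Finset.subset_univ, and_true]
  constructor
  · rintro ⟨⟨h1, h2⟩, rfl⟩
    refine ⟨⟨?_, subset_rfl⟩, rfl⟩
    rw [← h1]
    exact Finset.sum_subset (Finset.subset_univ _) fun i _ hi => Finsupp.notMem_support_iff.1 hi
  · rintro ⟨⟨h1, -⟩, rfl⟩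
    refine ⟨⟨?_, hσ⟩, rfl⟩
    rw [← h1]
    exact (Finset.sum_subset (Finset.subset_univ _)
      fun i _ hi => Finsupp.notMem_support_iff.1 hi).symm

/-- Power series with coefficients in a ring of functions can be compared pointwise. -/
theorem powerSeries_ext_eval {Y R : Type*} [Semiring R] {p q : PowerSeries (Y → R)}
    (h : ∀ g, PowerSeries.map (Pi.evalRingHom (fun _ : Y => R) g) p =
      PowerSeries.map (Pi.evalRingHom (fun _ : Y => R) g) q) : p = q := by
  ext m : 1
  funext g
  have := congrArg (PowerSeries.coeff m) (h g)
  rwa [PowerSeries.coeff_map, PowerSeries.coeff_map] at this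

theorem eqHilb_eq_invOneSubPow_mul_sum [Finite V] {C : Finset Γ}
    (hC : ∀ σ ∈ K, ∀ v ∈ σ, γ.color v ∈ C) :
    eqHilb ℂ A = ↑(PowerSeries.invOneSubPow (G → ℂ) C.card) *
      ∑ S ∈ C.powerset, PowerSeries.C (flagHChar A γ hγ S) * PowerSeries.X ^ S.card := by
  classical
  cases nonempty_fintype V
  suffices H : ∀ g, PowerSeries.map (Pi.evalRingHom (fun _ : G => ℂ) g) (eqHilb ℂ A) =
      PowerSeries.mk 1 ^ C.card * ∑ S ∈ C.powerset,
        PowerSeries.C (flagHChar A γ hγ S g) * PowerSeries.X ^ S.card by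
    have hmk : (↑(PowerSeries.invOneSubPow (G → ℂ) C.card) : PowerSeries (G → ℂ)) =
        PowerSeries.mk 1 ^ C.card := by
      rw [PowerSeries.invOneSubPow_eq_inv_one_sub_pow, Units.val_pow_eq_pow_val]
      rfl
    refine powerSeries_ext_eval fun g => ?_
    rw [H, hmk, map_mul, map_pow, map_sum]
    congr 1
    refine Finset.sum_congr rfl fun S _ => ?_
    rw [map_mul, map_pow, PowerSeries.map_X, PowerSeries.map_C]
    rfl
  intro g
  set y : PowerSeries ℂ := PowerSeries.X * PowerSeries.mk 1 with hy
  -- `PowerSeries.mk 1` is `1/(1-t)` and `y` is `t/(1-t)`.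
  have hb : (PowerSeries.mk 1 : PowerSeries ℂ) - y = 1 := by
    rw [hy, ← PowerSeries.mk_one_mul_one_sub_eq_one ℂ]
    ring
  have hflag : ∀ S, algebraMap ℂ (PowerSeries ℂ) (flagHChar A γ hγ S g) =
      flagTransform (fun T => algebraMap ℂ (PowerSeries ℂ) (flagFChar A γ hγ T g)) S := by
    intro S
    simp [flagHChar_apply, flagTransform]
  have h1 := sum_flagTransform_mul_pow
    (fun T => algebraMap ℂ (PowerSeries ℂ) (flagFChar A γ hγ T g)) C y (PowerSeries.mk 1)
  rw [hb] at h1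
  simp only [one_pow, mul_one] at h1
  rw [sum_flagFChar_mul A γ hγ C.powerset (fun T => y ^ T.card) g] at h1
  have h2 : (invariantFaces A g).filter (fun σ => σ.image γ.color ∈ C.powerset) =
      invariantFaces A g := by
    refine Finset.filter_true_of_mem fun σ hσ => Finset.mem_powerset.2 ?_
    exact Finset.image_subset_iff.2 fun v hv => hC σ ((mem_invariantFaces A).1 hσ).1 v hv
  have h3 : ∑ σ ∈ invariantFaces A g, y ^ (σ.image γ.color).card =
      ∑ σ ∈ invariantFaces A g, y ^ σ.card := Finset.sum_congr rfl fun σ hσ => by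
    rw [card_image_color γ ((mem_invariantFaces A).1 hσ).1]
  rw [map_eqHilb A γ hγ, ← hy, ← h3, ← h2, ← h1, Finset.mul_sum]
  refine Finset.sum_congr rfl fun S hS => ?_
  have hcard := Finset.card_le_card (Finset.mem_powerset.1 hS)
  rw [← hflag, hy, mul_pow, mul_assoc, ← pow_add, Nat.add_sub_of_le hcard,
    mul_comm (_ ^ _ : PowerSeries ℂ), mul_left_comm]
  rfl

theorem hChar_eq_sum_flagHChar [Finite V] {C : Finset Γ}
    (hC : ∀ σ ∈ K, ∀ v ∈ σ, γ.color v ∈ C) (hK : maxFaceCard K = C.card) (k : ℕ) :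
    hChar A k = ∑ S ∈ C.powersetCard k, flagHChar A γ hγ S := by
  have h := sum_powersetCard_flagTransform (flagFChar A γ hγ) C k
  rw [hChar, hK]
  simp only [fChar_eq_sum_flagFChar A γ hγ hC]
  exact h.symm

end InvariantFaces

/-! ### The order complex of `J(X)` -/

theorem finiteDimensional_subQuotient {𝕜 C : Type*} [Field 𝕜] [AddCommGroup C] [Module 𝕜 C]
    [FiniteDimensional 𝕜 C] (Z B : Submodule 𝕜 C) : FiniteDimensional 𝕜 (SubQuotient Z B) :=
  Module.Finite.of_surjective ((B.submoduleOf Z).mkQ : Z →ₗ[𝕜] SubQuotient Z B)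
    (Submodule.mkQ_surjective _)

theorem Icc_one_sub_one_subset_range (d : ℕ) : Finset.Icc 1 (d - 1) ⊆ Finset.range (d + 1) := by
  intro s hs
  rw [Finset.mem_Icc] at hs
  rw [Finset.mem_range]
  omega

section OrderIdeals

variable {X : Type*} [PartialOrder X] [Finite X]

theorem rankColoring_color_mem (I : LowerSet X) :
    (rankColoring X).color I ∈ Finset.range (Nat.card X + 1) := by
  rw [Finset.mem_range, Nat.lt_succ_iff]
  exact Set.ncard_le_card _

/-- `J(X)` has a chain with one member of each rank. -/
theorem exists_full_chain (X : Type*) [PartialOrder X] [Finite X] :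
    ∃ σ ∈ orderComplex (LowerSet X), σ.card = Nat.card X + 1 := by
  classical
  cases nonempty_fintype X
  let ω : X → LinearExtension X := toLinearExtension
  -- The full chain consists of the initial segments of a linear extension; `⊥` is a filler for
  -- sizes beyond `|X|`.
  have hinit : ∀ s, ∃ I : LowerSet X, s ≤ Nat.card X →
      (I : Set X).ncard = s ∧ ∀ x y, ω x < ω y → y ∈ I → x ∈ I := by
    intro s
    by_cases hs : s ≤ Nat.card X
    · obtain ⟨v, hv, h⟩ := exists_initial_segment ω (hs.trans_eq Nat.card_eq_fintype_card)
      refine ⟨⟨v, fun y x hxy hy => ?_⟩, fun _ => ⟨?_, h⟩⟩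
      · rcases (toLinearExtension.monotone hxy).lt_or_eq with h' | h'
        · exact h x y h' hy
        · exact (show x = y from h') ▸ hy
      · change (v : Set X).ncard = s
        rw [Set.ncard_coe_finset, hv]
    · exact ⟨⊥, fun h => absurd h hs⟩
  choose I hI using hinit
  refine ⟨(Finset.range (Nat.card X + 1)).image I, ?_, ?_⟩
  · intro J hJ J' hJ' _
    obtain ⟨s, hs, rfl⟩ := Finset.mem_image.1 (Finset.mem_coe.1 hJ)
    obtain ⟨t, ht, rfl⟩ := Finset.mem_image.1 (Finset.mem_coe.1 hJ')
    have hs := hI s (Nat.lt_succ_iff.1 (Finset.mem_range.1 hs))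
    have ht := hI t (Nat.lt_succ_iff.1 (Finset.mem_range.1 ht))
    by_contra! h
    obtain ⟨h1, h2⟩ := h
    obtain ⟨x, hx, hx'⟩ := Set.not_subset.1 h1
    obtain ⟨y, hy, hy'⟩ := Set.not_subset.1 h2
    rcases lt_trichotomy (ω x) (ω y) with h | h | h
    · exact hx' (ht.2 x y h hy)
    · exact hx' ((show x = y from h) ▸ hy)
    · exact hy' (hs.2 y x h hx)
  · rw [Finset.card_image_of_injOn, Finset.card_range]
    intro s hs t ht h
    rw [← (hI s (Nat.lt_succ_iff.1 (Finset.mem_range.1 hs))).1,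
      ← (hI t (Nat.lt_succ_iff.1 (Finset.mem_range.1 ht))).1, h]

theorem maxFaceCard_orderComplex :
    maxFaceCard (orderComplex (LowerSet X)) = (Finset.range (Nat.card X + 1)).card := by
  refine IsGreatest.csSup_eq ⟨?_, ?_⟩
  · rw [Finset.card_range]
    exact exists_full_chain X
  · rintro _ ⟨σ, hσ, rfl⟩
    exact Finset.card_le_card_of_injOn (rankColoring X).color
      (fun I _ => rankColoring_color_mem I) ((rankColoring X).injOn σ hσ)

variable {G : Type*} [Group G] (a : G →* (X ≃o X))

/-- Such an `S` contains `0` or `d`, the ranks of `⊥` and `⊤`. Each is alone in its rank and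
comparable to everything, hence a cone point. -/
theorem flagHChar_eq_zero {S : Finset ℕ} (hS : S ⊆ Finset.range (Nat.card X + 1))
    (hS' : ¬ S ⊆ Finset.Icc 1 (Nat.card X - 1)) :
    flagHChar (idealAction a) (rankColoring X) (idealAction_preserves a) S = 0 := by
  classical
  have hbot : (rankColoring X).color ⊥ = 0 := Set.ncard_empty X
  have htop : (rankColoring X).color ⊤ = Nat.card X := Set.ncard_univ X
  obtain ⟨s, hs, hs'⟩ := Finset.not_subset.1 hS'
  have hsX := Finset.mem_range.1 (hS hs)
  rw [Finset.mem_Icc] at hs'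
  have hs0 : s = 0 ∨ s = Nat.card X := by omega
  rcases hs0 with h0 | h0
  · refine flagHChar_eq_zero_of_cone _ _ _ (v := ⊥) (fun I hI => ?_) (fun σ hσ => ?_)
      (by rwa [hbot, ← h0])
    · rw [hbot] at hI
      exact SetLike.coe_injective ((Set.ncard_eq_zero (Set.toFinite _)).1 hI)
    · change IsChain (· ≤ ·) ((insert ⊥ σ : Finset (LowerSet X)) : Set (LowerSet X))
      rw [Finset.coe_insert]
      exact IsChain.insert hσ fun I _ _ => Or.inl bot_le
  · refine flagHChar_eq_zero_of_cone _ _ _ (v := ⊤) (fun I hI => ?_) (fun σ hσ => ?_)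
      (by rwa [htop, ← h0])
    · rw [htop] at hI
      exact SetLike.coe_injective ((Set.eq_univ_iff_ncard _).2 hI)
    · change IsChain (· ≤ ·) ((insert ⊤ σ : Finset (LowerSet X)) : Set (LowerSet X))
      rw [Finset.coe_insert]
      exact IsChain.insert hσ fun I _ _ => Or.inr le_top

theorem flagHChar_eq_homologyRep_character {S : Finset ℕ}
    (hS : S ⊆ Finset.Icc 1 (Nat.card X - 1)) :
    flagHChar (idealAction a) (rankColoring X) (idealAction_preserves a) S =
      (homologyRep ℂ ((rankColoring X).select S)
        ((idealAction a).select (rankColoring X) (idealAction_preserves a) S)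
        (idealAction_preserves a) S.card).character :=
  (flagHChar_eq_sum_fChar_select _ _ _ S).trans (homologyRep_character _ _ _
    (fun _ hn => rankSelected_cycleSpace_le_boundarySpace ℂ hS hn)
    (fun _ hσ => card_le_of_mem_colorSelect _ S hσ)).symm

theorem isEffective_flagHChar {S : Finset ℕ} (hS : S ⊆ Finset.range (Nat.card X + 1)) :
    IsEffective (flagHChar (idealAction a) (rankColoring X) (idealAction_preserves a) S) := by
  by_cases hS' : S ⊆ Finset.Icc 1 (Nat.card X - 1)
  · rw [flagHChar_eq_homologyRep_character a hS']
    have : FiniteDimensional ℂ (ReducedHomology ℂ ((rankColoring X).select S) S.card) :=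
      finiteDimensional_subQuotient _ _
    exact isEffective_of_representation _
  · rw [flagHChar_eq_zero a hS hS']
    exact isEffective_zero

end OrderIdeals

/-! ### Assembly of the theorem -/

theorem theorem6p4 {X G : Type*} [PartialOrder X] [Finite X] [Group G] [Finite G]
    (a : G →* (X ≃o X)) :
    -- the order polytope is invariant, and the two expressions of its equivariant Ehrhart series
    (∃ hP : ∀ g, coordRep a g '' orderPolytope X = orderPolytope X,
      eqEhr (coordRep a) (intLattice X) (coordRep_intLattice a) (orderPolytope X) hP =
        eqHilb ℂ (idealAction a) ∧
      eqEhr (coordRep a) (intLattice X) (coordRep_intLattice a) (orderPolytope X) hP =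
        ↑(PowerSeries.invOneSubPow (G → ℂ) (Nat.card X + 1)) *
          ∑ S ∈ (Finset.Icc 1 (Nat.card X - 1)).powerset,
            PowerSeries.C (flagHChar (idealAction a) (rankColoring X)
              (idealAction_preserves a) S) * PowerSeries.X ^ S.card) ∧
    -- the reduced homology of a rank-selected complex sits in the top degree `|S| - 1`, where it
    -- affords the flag `h`-entry
    (∀ S ⊆ Finset.Icc 1 (Nat.card X - 1),
      (∀ n, n ≠ S.card → Subsingleton (ReducedHomology ℂ ((rankColoring X).select S) n)) ∧
      flagHChar (idealAction a) (rankColoring X) (idealAction_preserves a) S =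
        (homologyRep ℂ ((rankColoring X).select S)
          ((idealAction a).select (rankColoring X) (idealAction_preserves a) S)
          (idealAction_preserves a) S.card).character) ∧
    -- all entries are effective
    (∀ k, IsEffective (hChar (idealAction a) k)) ∧
    (∀ S ⊆ Finset.range (Nat.card X + 1),
      IsEffective (flagHChar (idealAction a) (rankColoring X) (idealAction_preserves a) S)) ∧
    -- the flag `h`-vector refines the `h`-vector
    (∀ i, hChar (idealAction a) i =
      ∑ S ∈ (Finset.range (Nat.card X + 1)).powersetCard i,
        flagHChar (idealAction a) (rankColoring X) (idealAction_preserves a) S) ∧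
    (∀ i, hChar (idealAction a) i =
      ∑ S ∈ (Finset.Icc 1 (Nat.card X - 1)).powersetCard i,
        flagHChar (idealAction a) (rankColoring X) (idealAction_preserves a) S) := by
  have hC : ∀ σ ∈ orderComplex (LowerSet X), ∀ I ∈ σ,
      (rankColoring X).color I ∈ Finset.range (Nat.card X + 1) :=
    fun _ _ I _ => rankColoring_color_mem I
  have hh := hChar_eq_sum_flagHChar (idealAction a) (rankColoring X) (idealAction_preserves a) hC
    maxFaceCard_orderComplex
  refine ⟨⟨coordRep_image_orderPolytope a, eqEhr_eq_eqHilb a _, ?_⟩, fun S hS => ⟨fun n hn => ?_,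
    flagHChar_eq_homologyRep_character a hS⟩, fun k => ?_, fun S hS => isEffective_flagHChar a hS,
    hh, fun i => ?_⟩
  · rw [eqEhr_eq_eqHilb, eqHilb_eq_invOneSubPow_mul_sum (idealAction a) (rankColoring X)
      (idealAction_preserves a) hC, Finset.card_range]
    congr 1
    refine (Finset.sum_subset (Finset.powerset_mono.2 (Icc_one_sub_one_subset_range _))
      fun S hS hS' => ?_).symm
    rw [Finset.mem_powerset] at hS hS'
    rw [flagHChar_eq_zero a hS hS', map_zero, zero_mul]
  · refine subsingleton_reducedHomology ℂ _ ?_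
    rcases hn.lt_or_gt with h | h
    · exact rankSelected_cycleSpace_le_boundarySpace ℂ hS h
    -- Above the top degree there are no chains: a face uses each rank in `S` at most once.
    · rw [cycleSpace, chainSpace_eq_bot ℂ fun σ hσ =>
        ((card_le_of_mem_colorSelect _ S hσ).trans_lt h).ne, bot_inf_eq]
      exact bot_le
  · rw [hh]
    exact isEffective_sum _ _ fun S hS =>
      isEffective_flagHChar a (Finset.mem_powersetCard.1 hS).1
  · rw [hh]
    refine (Finset.sum_subset (Finset.powersetCard_mono (Icc_one_sub_one_subset_range _))
      fun S hS hS' => ?_).symm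
    rw [Finset.mem_powersetCard] at hS hS'
    exact flagHChar_eq_zero a hS.1 fun h => hS' ⟨h, hS.2⟩
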